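/- Let $L_1$ be the language with two sorts $O$ (objects) and $F$ (functions), a binary relation symbol $E$ and a binary function symbol $\mathrm{eval}$. Let $T_1$ be the theory saying that $O$ and $F$ are disjoint with union the universe, that $E\subseteq O^2$ is an equivalence relation on $O$, and that $\mathrm{eval}:F\times O\to O$ satisfies, for every $f\in F$ and all $b,b'\in O$: $E(\mathrm{eval}(f,b),b)$, and if $E(b,b')$ then $\mathrm{eval}(f,b)=\mathrm{eval}(f,b')$. (Formally, $O$ and $F$ are unary predicates of a one-sorted language, and $\mathrm{eval}$ is made total by putting $\mathrm{eval}(x,y)=x$ outside $F\times O$.) Let $\mathbb{K}_1$ be the class of finite models of $T_1$, the empty one included. The class $\mathbb{K}_1$ has a Fraïssé limit, i.e. there is a countable ultrahomogeneous $L_1$-structure whose age is $\mathbb{K}_1$. Let $T_1^*$ be the complete theory of a Fraïssé limit of $\mathbb{K}_1$ (any two are isomorphic). Then: 1. $T_1^*$ is NSOP$_1$: there are no formula $\varphi(x;y)$, with $x$, $y$ finite tuples of variables, and tuples $(a_\eta)_{\eta\in 2^{<\omega}}$ in a model of $T_1^*$ such that $\{\varphi(x;a_{\eta|i}):i<\omega\}$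 is consistent for all $\eta\in 2^{\omega}$, and $\{\varphi(x;a_\nu),\varphi(x;a_{\eta\frown\langle 1\rangle})\}$ is inconsistent for all $\eta,\nu\in 2^{<\omega}$ with $\nu\trianglerighteq\eta\frown\langle 0\rangle$. 2. Modulo $T_1^*$, the formula $O(x)$ axiomatizes a complete type $p(x)$ over $\emptyset$ in one variable: $O(x)\in p$, and $T_1^*\vdash O(x)\to\psi(x)$ for every $\psi\in p$. 3. The type $p$ is simple: there are no formula $\varphi(x;y)$ (with $x$ the variable of $p$ and $y$ a finite tuple), tuples $(a_\eta)_{\eta\in\omega^{<\omega}}$ in a model of $T_1^*$ and $k<\omega$ such that $\{\varphi(x;a_{\eta\frown\langle i\rangle}):i<\omega\}$ is $k$-inconsistent for all $\eta\in\omega^{<\omega}$ and $p(x)\cup\{\varphi(x;a_{\eta|i}):i<\omega\}$ is consistent for all $\eta\in\omega^{\omega}$. 4. The type $p$ is not co-simple: there are a formula $\varphi(x;y)$ (with $x$ a finite tuple and $y$ a single variable), realizations $(a_\eta)_{\eta\in\omega^{<\omega}}$ of $p$ in a model of $T_1^*$ and $k<\omega$ such that $\{\varphi(x;a_{\eta\frown\langle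 i\rangle}):i<\omega\}$ is $k$-inconsistent for all $\eta\in\omega^{<\omega}$ and $\{\varphi(x;a_{\eta|i}):i<\omega\}$ is consistent for all $\eta\in\omega^{\omega}$. Here a set of formulas with parameters in a model is consistent if each finite subset is satisfied in that model, and a family $(\varphi(x;b_i))_{i<\omega}$ is $k$-inconsistent if no $k$ members with distinct indices are satisfied together. In particular there is a simple type that is not co-simple, which answers a question of Chernikov. -/

import Mathlib

open FirstOrder FirstOrder.Language

/-! ### Combinatorial tree properties -/

namespace TreeProperties

universe u v

variable {L : FirstOrder.Language.{u, v}}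

/-- A family of sets has the finite intersection property.  For the family of solution sets, in a
structure `M`, of a family of formulas with parameters in `M`, this says that the family of formulas
is consistent (with the elementary diagram of `M`); in a monster model it says that the family,
if small, is realized. -/
def Consistent {ι X : Type*} (D : ι → Set X) : Prop :=
  ∀ s : Finset ι, (⋂ i ∈ s, D i).Nonempty

/-- Any `k` members of the family (with distinct indices) have empty intersection. -/
def KInconsistent {ι X : Type*} (k : ℕ) (D : ι → Set X) : Prop :=
  ∀ s : Finset ι, s.card = k → ¬ (⋂ i ∈ s, D i).Nonempty

/-- The solution set in `M` of the formula `φ(x; b)`. -/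
def solutions {M : Type*} [L.Structure M] {α β : Type} (φ : L.Formula (α ⊕ β)) (b : β → M) :
    Set (α → M) :=
  {x | φ.Realize (Sum.elim x b)}

/-- The restriction `η | n = ⟨η 0, …, η (n - 1)⟩` of an infinite branch `η`.
Nodes of the trees `2^{<ω}` and `ω^{<ω}` are finite lists. -/
def restrict {A : Type} (η : ℕ → A) (n : ℕ) : List A :=
  (List.range n).map η

/-- `φ(x; y)` has SOP₁ modulo `T`.  The entries `0`, `1` of the nodes are `false`, `true`. -/
def HasSOP1 (T : L.Theory) {m n : ℕ} (φ : L.Formula (Fin m ⊕ Fin n)) : Prop :=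
  ∃ (M : Theory.ModelType.{u, v, max u v} T) (a : List Bool → Fin n → M),
    (∀ η : ℕ → Bool, Consistent fun i : ℕ => solutions φ (a (restrict η i))) ∧
    ∀ η ν : List Bool, (η ++ [false]) <+: ν →
      ¬ (solutions φ (a ν) ∩ solutions φ (a (η ++ [true]))).Nonempty

/-- `T` is NSOP₁: no formula has SOP₁ modulo `T`. -/
def NSOP1 (T : L.Theory) : Prop :=
  ∀ (m n : ℕ) (φ : L.Formula (Fin m ⊕ Fin n)), ¬ HasSOP1 T φ

/-- A partial type `π(x)` over `∅` is simple: no instance of the tree property is consistent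
with `π`. -/
def IsSimpleType (T : L.Theory) {m : ℕ} (π : Set (L.Formula (Fin m))) : Prop :=
  ¬ ∃ (n : ℕ) (φ : L.Formula (Fin m ⊕ Fin n)) (k : ℕ)
      (M : Theory.ModelType.{u, v, max u v} T) (a : List ℕ → Fin n → M),
    (∀ η : List ℕ, KInconsistent k fun i : ℕ => solutions φ (a (η ++ [i]))) ∧
    ∀ η : ℕ → ℕ, Consistent (Sum.elim
      (fun ψ : π => {x : Fin m → M | ψ.1.Realize x})
      (fun i : ℕ => solutions φ (a (restrict η i))))

/-- A partial type `π` over `∅` is co-simple: the tree property is not witnessed by parameters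
realizing `π`.  Here `x` is an arbitrary finite tuple, and the variables `y` of `φ(x; y)` are
those of `π`. -/
def IsCoSimpleType (T : L.Theory) {m : ℕ} (π : Set (L.Formula (Fin m))) : Prop :=
  ¬ ∃ (n : ℕ) (φ : L.Formula (Fin n ⊕ Fin m)) (k : ℕ)
      (M : Theory.ModelType.{u, v, max u v} T) (a : List ℕ → Fin m → M),
    (∀ η : List ℕ, KInconsistent k fun i : ℕ => solutions φ (a (η ++ [i]))) ∧
    (∀ η : ℕ → ℕ, Consistent fun i : ℕ => solutions φ (a (restrict η i))) ∧
    ∀ (η : List ℕ), ∀ ψ ∈ π, ψ.Realize (a η)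

/-- The set of formulas (without parameters) belonging to a complete type over `∅`. -/
def formulasOf {T : L.Theory} {m : ℕ} (p : T.CompleteType (Fin m)) : Set (L.Formula (Fin m)) :=
  {ψ | Formula.equivSentence ψ ∈ p}

/-- Modulo `T`, the formula `θ(x)` axiomatizes (isolates) the complete type `p(x)` over `∅`. -/
def Axiomatizes (T : L.Theory) {m : ℕ} (θ : L.Formula (Fin m)) (p : T.CompleteType (Fin m)) :
    Prop :=
  θ ∈ formulasOf p ∧ ∀ ψ ∈ formulasOf p, T ⊨ᵇ θ.imp ψ

end TreeProperties

/-! ### Equivalence relations with selector functions -/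

namespace Selector

/-- The function symbols of `L₁`: one binary symbol `eval`. -/
inductive Func : ℕ → Type
  | eval : Func 2

/-- The relation symbols of `L₁`: unary `O` (objects), unary `F` (functions), binary `E`. -/
inductive Rel : ℕ → Type
  | O : Rel 1
  | F : Rel 1
  | E : Rel 2

/-- The language `L₁`, as a one-sorted language; the two sorts are unary predicates. -/
def L₁ : FirstOrder.Language.{0, 0} := ⟨Func, Rel⟩

/-- The symbol `O` of `L₁`. -/
def symO : L₁.Relations 1 := Rel.O

/-- The symbol `F` of `L₁`. -/
def symF : L₁.Relations 1 := Rel.F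

/-- The symbol `E` of `L₁`. -/
def symE : L₁.Relations 2 := Rel.E

/-- The symbol `eval` of `L₁`. -/
def symEval : L₁.Functions 2 := Func.eval

instance : Countable (Σ l, L₁.Functions l) := by
  have : Subsingleton (Σ l, L₁.Functions l) := by
    constructor
    rintro ⟨_, ⟨⟩⟩ ⟨_, ⟨⟩⟩
    rfl
  infer_instance

section Formulas

variable {α : Type} {n : ℕ}

/-- The atomic formula `O(t)`. -/
def isO (t : L₁.Term (α ⊕ Fin n)) : L₁.BoundedFormula α n :=
  Relations.boundedFormula₁ symO t

/-- The atomic formula `F(t)`. -/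
def isF (t : L₁.Term (α ⊕ Fin n)) : L₁.BoundedFormula α n :=
  Relations.boundedFormula₁ symF t

/-- The atomic formula `E(s, t)`. -/
def relE (s t : L₁.Term (α ⊕ Fin n)) : L₁.BoundedFormula α n :=
  Relations.boundedFormula₂ symE s t

/-- The term `eval(s, t)`. -/
def evalT (s t : L₁.Term (α ⊕ Fin n)) : L₁.Term (α ⊕ Fin n) :=
  Functions.apply₂ symEval s t

end Formulas

/-- The theory `T₁`.  The axioms say, in this order:
`O` and `F` are disjoint and cover the universe; `E ⊆ O²`; `E` is reflexive on `O`, symmetric,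
transitive; for `f ∈ F` and `b ∈ O`, `eval(f, b)` is `E`-equivalent to `b` (so it lies in `O`);
for `f ∈ F` and `E`-equivalent `b, b'`, `eval(f, b) = eval(f, b')`.  The last axiom is the usual
convention that makes the partial function `eval : F × O → O` total in a one-sorted language:
outside `F × O` it returns its first argument. -/
def T₁ : L₁.Theory :=
  { ∀' (isO &0 ⇔ ∼(isF &0)),
    ∀' ∀' (relE &0 &1 ⟹ (isO &0 ⊓ isO &1)),
    ∀' (isO &0 ⟹ relE &0 &0),
    ∀' ∀' (relE &0 &1 ⟹ relE &1 &0),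
    ∀' ∀' ∀' (relE &0 &1 ⟹ relE &1 &2 ⟹ relE &0 &2),
    ∀' ∀' (isF &0 ⟹ isO &1 ⟹ relE (evalT &0 &1) &1),
    ∀' ∀' ∀' (isF &0 ⟹ relE &1 &2 ⟹ (evalT &0 &1 =' evalT &0 &2)),
    ∀' ∀' (∼(isF &0 ⊓ isO &1) ⟹ (evalT &0 &1 =' &0)) }

section Semantics

variable {M : Type*} [L₁.Structure M]

/-- The interpretation of `O`. -/
def O (x : M) : Prop := Structure.RelMap symO ![x]

/-- The interpretation of `F`. -/
def F (x : M) : Prop := Structure.RelMap symF ![x]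

/-- The interpretation of `E`. -/
def E (x y : M) : Prop := Structure.RelMap symE ![x, y]

/-- The interpretation of `eval`. -/
def eval (x y : M) : M := Structure.funMap symEval ![x, y]

end Semantics

/-- The meaning of the axioms of `T₁` in a structure. -/
theorem model_T₁_iff (M : Type*) [L₁.Structure M] :
    M ⊨ T₁ ↔
      (∀ x : M, O x ↔ ¬ F x) ∧
      (∀ x y : M, E x y → O x ∧ O y) ∧
      (∀ x : M, O x → E x x) ∧
      (∀ x y : M, E x y → E y x) ∧
      (∀ x y z : M, E x y → E y z → E x z) ∧
      (∀ f b : M, F f → O b → E (eval f b) b) ∧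
      (∀ f b b' : M, F f → E b b' → eval f b = eval f b') ∧
      (∀ x y : M, ¬ (F x ∧ O y) → eval x y = x) := by
  simp [T₁, isO, isF, relE, evalT, O, F, E, eval, Sentence.Realize, Formula.Realize,
    BoundedFormula.realize_rel₁, BoundedFormula.realize_rel₂, Fin.snoc]

/-- The class `𝕂₁` of finite models of `T₁`. -/
def K₁ : Set (CategoryTheory.Bundled.{0} L₁.Structure) :=
  {M | Finite M ∧ M ⊨ T₁}

/-- The formula `O(x)` in one free variable. -/
def formulaO : L₁.Formula (Fin 1) :=
  isO (Term.var (Sum.inl 0))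

end Selector

/-! All work takes place in the structures `Pt r`: classes, functions and the elements of each class
are numbered by ℕ, and `r f κ` is the element that `f` selects in class `κ`. `Generic r` is the
extension property: finitely many values of a new function, or the equality pattern of finitely many
functions on a new class, are arbitrary. Partial isomorphisms are good frames, whose domain is
finitely many functions together with finitely many entire classes. Between generic structures they
extend back and forth, so they preserve all formulas (`Good.realize_iff`). Hence `Pt r` is a Fraïssé
limit and all objects have one type over ∅. The extension property is first-order, so by
Löwenheim–Skolem countably many elements of any model of the theory lie in an elementary submodel
isomorphic to a generic `Pt r` (`Generic.exists_elementaryEmbedding`). It remains to study trees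
there.

The engine for consistency is the simultaneous extension of several frames with a common image for
the new point (`exists_extend_class`, `exists_extend_fn`, `Coherent.exists_settle_all`). It works
when the frames make no conflicting demands on that image.

Simplicity: a formula with `k`-inconsistent instances can hold of an object only if a finite set
captures the object, or its class, for the first time (`exists_new_of_kInconsistent`). Each happens
at most once, so no path of length three survives.

NSOP₁: `exists_amalgam` is an independence theorem. Pigeonhole on `rank`, a bounded count of how
much a finite tuple meets a growing chain of finite sets, finds a place on a branch where its
hypotheses hold. The amalgam then satisfies two instances that SOP₁ makes inconsistent.

Failure of co-simplicity: in `F(x) ∧ eval(x, y) = y`, let level `n` of the tree run through class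
`n`. Siblings compete for the value on one class, while a branch prescribes values on distinct
classes. -/

namespace Selector

open Equiv

/-! ### Concrete models of `T₁`. -/

/-- The model of `T₁` with classes and functions indexed by `ℕ`, with classes enumerated by `ℕ`,
in which the function `f` selects the element `r f κ` of the class `κ`. -/
inductive Pt (r : ℕ → ℕ → ℕ) : Type
  | obj (κ n : ℕ) : Pt r
  | fn (f : ℕ) : Pt r

namespace Pt

variable {r r' : ℕ → ℕ → ℕ}

/-- The function `eval` of `Pt r`. -/
def evalFun : Pt r → Pt r → Pt r
  | fn f, obj κ _ => obj κ (r f κ)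
  | x, _ => x

/-- The predicate `O` of `Pt r`. -/
def IsObj : Pt r → Prop
  | obj _ _ => True
  | fn _ => False

/-- The relation `E` of `Pt r`. -/
def SameClass : Pt r → Pt r → Prop
  | obj κ _, obj κ' _ => κ = κ'
  | _, _ => False

instance : L₁.Structure (Pt r) where
  funMap {n} (f : Func n) v := match n, f, v with
    | _, Func.eval, v => evalFun (v 0) (v 1)
  RelMap {n} (R : Rel n) v := match n, R, v with
    | _, Rel.O, v => IsObj (v 0)
    | _, Rel.F, v => ¬ IsObj (v 0)
    | _, Rel.E, v => SameClass (v 0) (v 1)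

@[simp] theorem O_obj (κ n : ℕ) : O (obj κ n : Pt r) := trivial
@[simp] theorem not_O_fn (f : ℕ) : ¬ O (fn f : Pt r) := id
@[simp] theorem F_fn (f : ℕ) : F (fn f : Pt r) := id
@[simp] theorem not_F_obj (κ n : ℕ) : ¬ F (obj κ n : Pt r) := fun h => h trivial
@[simp] theorem E_obj_obj (κ n κ' n' : ℕ) : E (obj κ n : Pt r) (obj κ' n') ↔ κ = κ' := Iff.rfl
@[simp] theorem not_E_fn_left (f : ℕ) (x : Pt r) : ¬ E (fn f) x := id
@[simp] theorem not_E_fn_right (f : ℕ) (x : Pt r) : ¬ E x (fn f) := by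
  cases x <;> exact id
@[simp] theorem eval_fn_obj (f κ n : ℕ) : eval (fn f : Pt r) (obj κ n) = obj κ (r f κ) := rfl
@[simp] theorem eval_fn_fn (f g : ℕ) : eval (fn f : Pt r) (fn g) = fn f := rfl
@[simp] theorem eval_obj (κ n : ℕ) (x : Pt r) : eval (obj κ n : Pt r) x = obj κ n := by
  cases x <;> rfl

instance : Nonempty (Pt r) := ⟨fn 0⟩

instance : Infinite (Pt r) := Infinite.of_injective fn fun _ _ h => by injection h

instance : Countable (Pt r) := by
  have : Function.Injective (fun x : Pt r => match x with
      | obj κ n => (Sum.inl (κ, n) : (ℕ × ℕ) ⊕ ℕ)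
      | fn f => Sum.inr f) := by
    rintro (⟨κ, n⟩ | f) (⟨κ', n'⟩ | f') h <;> simp_all
  exact this.countable

theorem model_T₁ (r : ℕ → ℕ → ℕ) : Pt r ⊨ T₁ := by
  rw [model_T₁_iff]
  refine ⟨?_, ?_, ?_, ?_, ?_, ?_, ?_, ?_⟩
  · rintro (_ | _) <;> simp
  · rintro (_ | _) (_ | _) <;> simp
  · rintro (_ | _) <;> simp
  · rintro (_ | _) (_ | _) <;> simp [eq_comm]
  · rintro (_ | _) (_ | _) (_ | _) <;> simp
    rintro rfl rfl; rfl
  · rintro (_ | _) (_ | _) <;> simp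
  · rintro (_ | _) (_ | _) (_ | _) <;> simp
    rintro rfl; simp
  · rintro (_ | _) (_ | _) <;> simp

end Pt

/-! ### Genericity, frames and back-and-forth. -/

/-- Genericity of `r`: finitely many values of a new function, and finitely many values on a new
class (up to a permutation of that class), can be prescribed. -/
structure Generic (r : ℕ → ℕ → ℕ) : Prop where
  exists_fn : ∀ (Φ K : Finset ℕ) (v : ℕ → ℕ), ∃ f ∉ Φ, ∀ κ ∈ K, r f κ = v κ
  exists_class : ∀ (Φ K : Finset ℕ) (v : ℕ → ℕ), ∃ κ ∉ K, ∃ g : Perm ℕ, ∀ f ∈ Φ, r f κ = g (v f)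

/-- The data of an isomorphism of the reducts of `Pt r` and `Pt r'` to `O`, `F` and `E`:
bijections between functions, between classes, and between corresponding classes. -/
structure Frame where
  /-- the bijection of the functions -/
  σ : Perm ℕ
  /-- the bijection of the classes -/
  τ : Perm ℕ
  /-- the bijection of the class `κ` with the class `τ κ` -/
  h : ℕ → Perm ℕ

namespace Frame

open Pt

variable {r r' : ℕ → ℕ → ℕ}

/-- The map of structures given by a frame. -/
def map (A : Frame) : Pt r → Pt r'
  | obj κ n => obj (A.τ κ) (A.h κ n)
  | fn f => fn (A.σ f)

@[simp] theorem map_obj (A : Frame) (κ n : ℕ) :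
    (A.map (obj κ n : Pt r) : Pt r') = obj (A.τ κ) (A.h κ n) := rfl
@[simp] theorem map_fn (A : Frame) (f : ℕ) : (A.map (fn f : Pt r) : Pt r') = fn (A.σ f) := rfl

/-- The inverse frame. -/
def symm (A : Frame) : Frame := ⟨A.σ.symm, A.τ.symm, fun κ => (A.h (A.τ.symm κ)).symm⟩

/-- The identity frame. -/
def refl : Frame := ⟨1, 1, 1⟩

@[simp] theorem refl_map (x : Pt r) : (refl.map x : Pt r) = x := by
  cases x <;> rfl

@[simp] theorem symm_map_map (A : Frame) (x : Pt r) : A.symm.map (A.map x : Pt r') = x := by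
  cases x <;> simp [symm]

@[simp] theorem map_symm_map (A : Frame) (x : Pt r') : A.map (A.symm.map x : Pt r) = x := by
  cases x <;> simp [symm]

theorem map_injective (A : Frame) : Function.Injective (A.map : Pt r → Pt r') :=
  Function.LeftInverse.injective A.symm_map_map

theorem O_map (A : Frame) (x : Pt r) : O (A.map x : Pt r') ↔ O x := by
  cases x <;> simp

theorem F_map (A : Frame) (x : Pt r) : F (A.map x : Pt r') ↔ F x := by
  cases x <;> simp

theorem E_map (A : Frame) (x y : Pt r) : E (A.map x : Pt r') (A.map y) ↔ E x y := by
  cases x <;> cases y <;> simp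

/-- The frame `A` respects the values of the functions in `Φ` on the classes in `K`. -/
def Good (r r' : ℕ → ℕ → ℕ) (A : Frame) (Φ K : Finset ℕ) : Prop :=
  ∀ f ∈ Φ, ∀ κ ∈ K, r' (A.σ f) (A.τ κ) = A.h κ (r f κ)

/-- The substructure of the functions in `Φ` and the objects with class in `K`. -/
def Dom (Φ K : Finset ℕ) : Pt r → Prop
  | obj κ _ => κ ∈ K
  | fn f => f ∈ Φ

@[simp] theorem dom_obj (Φ K : Finset ℕ) (κ n : ℕ) : Dom Φ K (obj κ n : Pt r) ↔ κ ∈ K := Iff.rfl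
@[simp] theorem dom_fn (Φ K : Finset ℕ) (f : ℕ) : Dom Φ K (fn f : Pt r) ↔ f ∈ Φ := Iff.rfl

theorem Dom.mono {Φ K Φ' K' : Finset ℕ} (h₁ : Φ ⊆ Φ') (h₂ : K ⊆ K') {x : Pt r} (h : Dom Φ K x) :
    Dom Φ' K' x := by
  cases x
  · exact h₂ h
  · exact h₁ h

theorem Dom.eval {Φ K : Finset ℕ} {x y : Pt r} (hx : Dom Φ K x) (hy : Dom Φ K y) :
    Dom Φ K (eval x y) := by
  cases x <;> cases y <;> simp_all

theorem Good.mono {A : Frame} {Φ K Φ' K' : Finset ℕ} (h₁ : Φ ⊆ Φ') (h₂ : K ⊆ K')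
    (h : Good r r' A Φ' K') : Good r r' A Φ K :=
  fun f hf κ hκ => h f (h₁ hf) κ (h₂ hκ)

theorem Good.map_eval {A : Frame} {Φ K : Finset ℕ} (h : Good r r' A Φ K) {x y : Pt r}
    (hx : Dom Φ K x) (hy : Dom Φ K y) : (A.map (Selector.eval x y) : Pt r') =
      Selector.eval (A.map x) (A.map y) := by
  cases x <;> cases y <;> simp
  exact (h _ hx _ hy).symm

theorem Good.symm {A : Frame} {Φ K : Finset ℕ} (h : Good r r' A Φ K) :
    Good r' r A.symm (Φ.map A.σ.toEmbedding) (K.map A.τ.toEmbedding) := by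
  intro f hf κ hκ
  simp only [Finset.mem_map, toEmbedding_apply] at hf hκ
  obtain ⟨f, hf, rfl⟩ := hf
  obtain ⟨κ, hκ, rfl⟩ := hκ
  simp [Frame.symm, h f hf κ hκ]

theorem dom_map_iff {A : Frame} {Φ K : Finset ℕ} {x : Pt r} :
    Dom (Φ.map A.σ.toEmbedding) (K.map A.τ.toEmbedding) (A.map x : Pt r') ↔ Dom Φ K x := by
  cases x <;> simp

theorem exists_factor {ι : Sort*} {p q : ι → ℕ} (h : ∀ i j, p i = p j → q i = q j) :
    ∃ v : ℕ → ℕ, ∀ i, v (p i) = q i :=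
  have hf : q.FactorsThrough p := fun i j => h i j
  ⟨Function.extend p q 0, fun i => hf.extend_apply 0 i⟩

/-- A new class can be added simultaneously, with the same image, to the domains of finitely many
frames. -/
theorem exists_extend_class (hr' : Generic r') {S : Type*} [Finite S] (A : S → Frame)
    (Φ K : S → Finset ℕ) (hA : ∀ s, Good r r' (A s) (Φ s) (K s)) (κ : ℕ) (hκ : ∀ s, κ ∉ K s)
    (hcoh : ∀ s s', ∀ f ∈ Φ s, ∀ f' ∈ Φ s', (A s).σ f = (A s').σ f' → f = f') (L : Finset ℕ) :
    ∃ κ' ∉ L, ∃ g : Perm ℕ, ∃ B : S → Frame, ∀ s, (B s).σ = (A s).σ ∧ (B s).τ κ = κ' ∧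
      (B s).h κ = g ∧ (∀ i ∈ K s, (B s).τ i = (A s).τ i) ∧ (∀ i ∈ K s, (B s).h i = (A s).h i) ∧
      Good r r' (B s) (Φ s) (insert κ (K s)) := by
  classical
  have := Fintype.ofFinite S
  -- The frame `s` wants the function `(A s).σ f` to select on the new class the copy of `r f κ`. By
  -- `hcoh` these demands define one function `v` of the image.
  obtain ⟨v, hv⟩ := exists_factor (ι := Σ s, Φ s) (p := fun i => (A i.1).σ i.2)
    (q := fun i => r i.2 κ) (by
      rintro ⟨s, f, hf⟩ ⟨s', f', hf'⟩ h
      exact congrArg (r · κ) (hcoh s s' f hf f' hf' h))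
  obtain ⟨κ', hκ', g, hg⟩ := hr'.exists_class
    (Finset.univ.biUnion fun s => (Φ s).map (A s).σ.toEmbedding)
    (L ∪ Finset.univ.biUnion fun s => (K s).map (A s).τ.toEmbedding) v
  simp only [Finset.mem_union, Finset.mem_biUnion, Finset.mem_univ, true_and, Finset.mem_map,
    toEmbedding_apply, not_or, not_exists, not_and, forall_exists_index, and_imp] at hκ' hg
  -- The transposition redirects `κ` to `κ'`. It leaves the images of `K s` alone, since `κ'` was
  -- chosen outside them.
  refine ⟨κ', hκ'.1, g, fun s => ⟨(A s).σ, swap ((A s).τ κ) κ' * (A s).τ,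
    Function.update (A s).h κ g⟩, fun s => ?_⟩
  have hne : ∀ i ∈ K s, i ≠ κ := fun i hi e => hκ s (e ▸ hi)
  have hτ : ∀ i ∈ K s, (swap ((A s).τ κ) κ' * (A s).τ) i = (A s).τ i := by
    intro i hi
    rw [Perm.mul_apply, swap_apply_of_ne_of_ne]
    · simpa using hne i hi
    · exact hκ'.2 s i hi
  refine ⟨rfl, by simp, by simp, hτ, fun i hi => Function.update_of_ne (hne i hi) _ _, ?_⟩
  intro f hf i hi
  rcases Finset.mem_insert.1 hi with rfl | hi
  · have := hv ⟨s, f, hf⟩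
    simp only at this
    simp [hg _ s f hf rfl, this]
  · simp only [hτ i hi, Function.update_of_ne (hne i hi)]
    exact hA s f hf i hi

/-- A new function can be added simultaneously, with the same image, to the domains of finitely
many frames. -/
theorem exists_extend_fn (hr' : Generic r') {S : Type*} [Finite S] (A : S → Frame)
    (Φ K : S → Finset ℕ) (hA : ∀ s, Good r r' (A s) (Φ s) (K s)) (f : ℕ) (hf : ∀ s, f ∉ Φ s)
    (hcoh : ∀ s s', ∀ κ ∈ K s, ∀ κ' ∈ K s', (A s).τ κ = (A s').τ κ' →
      (A s).h κ (r f κ) = (A s').h κ' (r f κ')) (L : Finset ℕ) :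
    ∃ f' ∉ L, ∃ B : S → Frame, ∀ s, (B s).τ = (A s).τ ∧ (B s).h = (A s).h ∧ (B s).σ f = f' ∧
      (∀ i ∈ Φ s, (B s).σ i = (A s).σ i) ∧ Good r r' (B s) (insert f (Φ s)) (K s) := by
  classical
  have := Fintype.ofFinite S
  obtain ⟨v, hv⟩ := exists_factor (ι := Σ s, K s) (p := fun i => (A i.1).τ i.2)
    (q := fun i => (A i.1).h i.2 (r f i.2)) (by
      rintro ⟨s, κ, hκ⟩ ⟨s', κ', hκ'⟩ h
      exact hcoh s s' κ hκ κ' hκ' h)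
  obtain ⟨f', hf', hg⟩ := hr'.exists_fn
    (L ∪ Finset.univ.biUnion fun s => (Φ s).map (A s).σ.toEmbedding)
    (Finset.univ.biUnion fun s => (K s).map (A s).τ.toEmbedding) v
  simp only [Finset.mem_union, Finset.mem_biUnion, Finset.mem_univ, true_and, Finset.mem_map,
    toEmbedding_apply, not_or, not_exists, not_and, forall_exists_index, and_imp] at hf' hg
  refine ⟨f', hf'.1, fun s => ⟨swap ((A s).σ f) f' * (A s).σ, (A s).τ, (A s).h⟩, fun s => ?_⟩
  have hσ : ∀ i ∈ Φ s, (swap ((A s).σ f) f' * (A s).σ) i = (A s).σ i := by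
    intro i hi
    rw [Perm.mul_apply, swap_apply_of_ne_of_ne]
    · simpa using fun e : i = f => hf s (e ▸ hi)
    · exact hf'.2 s i hi
  refine ⟨rfl, rfl, by simp, hσ, ?_⟩
  intro i hi κ hκ
  rcases Finset.mem_insert.1 hi with rfl | hi
  · have := hv ⟨s, κ, hκ⟩
    simp only at this
    simp [hg _ s κ hκ rfl, this]
  · simp only [hσ i hi]
    exact hA s i hi κ hκ

/-- A single frame is the case of a one-element family: coherence is then just injectivity of `σ`
and `τ`. -/
theorem Good.exists_extend (hr' : Generic r') {A : Frame} {Φ K : Finset ℕ}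
    (hA : Good r r' A Φ K) (x : Pt r) :
    ∃ (B : Frame) (Φ' K' : Finset ℕ), Φ ⊆ Φ' ∧ K ⊆ K' ∧ Good r r' B Φ' K' ∧ Dom Φ' K' x ∧
      ∀ y : Pt r, Dom Φ K y → (B.map y : Pt r') = A.map y := by
  classical
  rcases x with ⟨κ, n⟩ | f
  · by_cases hκ : κ ∈ K
    · exact ⟨A, Φ, K, subset_rfl, subset_rfl, hA, hκ, fun _ _ => rfl⟩
    obtain ⟨κ', -, g, B, hB⟩ := exists_extend_class hr' (fun _ : Unit => A) (fun _ => Φ)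
      (fun _ => K) (fun _ => hA) κ (fun _ => hκ) (fun _ _ f _ f' _ h => A.σ.injective h) ∅
    obtain ⟨h1, -, -, h4, h5, h6⟩ := hB ()
    refine ⟨B (), Φ, insert κ K, subset_rfl, Finset.subset_insert _ _, h6, by simp, ?_⟩
    rintro (⟨i, n⟩ | f) hy
    · simp [h4 i hy, h5 i hy]
    · simp [h1]
  · by_cases hf : f ∈ Φ
    · exact ⟨A, Φ, K, subset_rfl, subset_rfl, hA, hf, fun _ _ => rfl⟩
    obtain ⟨f', -, B, hB⟩ := exists_extend_fn hr' (fun _ : Unit => A) (fun _ => Φ)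
      (fun _ => K) (fun _ => hA) f (fun _ => hf)
      (fun _ _ κ _ κ' _ h => by rw [A.τ.injective h]) ∅
    obtain ⟨h1, h2, -, h4, h5⟩ := hB ()
    refine ⟨B (), insert f Φ, K, Finset.subset_insert _ _, subset_rfl, h5, by simp, ?_⟩
    rintro (⟨i, n⟩ | f) hy
    · simp [h1, h2]
    · simp [h4 f hy]

theorem Good.map_term {A : Frame} {Φ K : Finset ℕ} (hA : Good r r' A Φ K) {β : Type*}
    {v : β → Pt r} (hv : ∀ b, Dom Φ K (v b)) (t : L₁.Term β) :
    Dom Φ K (t.realize v) ∧ (A.map (t.realize v) : Pt r') = t.realize (A.map ∘ v) := by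
  induction t with
  | var b => exact ⟨hv b, rfl⟩
  | func f ts ih =>
    obtain ⟨⟩ := f
    have e : ∀ {q : ℕ → ℕ → ℕ} (w : β → Pt q), (Term.func Func.eval ts : L₁.Term β).realize w =
        Selector.eval ((ts 0).realize w) ((ts 1).realize w) := fun w => rfl
    rw [e, e, ← (ih 0).2, ← (ih 1).2]
    exact ⟨(ih 0).1.eval (ih 1).1, hA.map_eval (ih 0).1 (ih 1).1⟩

/-- Formulas are preserved by a good frame. -/
theorem Good.realize_iff (hr : Generic r) (hr' : Generic r') {β : Type*} {n : ℕ}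
    (φ : L₁.BoundedFormula β n) {A : Frame} {Φ K : Finset ℕ} (hA : Good r r' A Φ K)
    {v : β → Pt r} {xs : Fin n → Pt r} (hv : ∀ b, Dom Φ K (v b)) (hxs : ∀ i, Dom Φ K (xs i)) :
    φ.Realize v xs ↔ φ.Realize (M := Pt r') (A.map ∘ v) (A.map ∘ xs) := by
  induction φ generalizing A Φ K with
  | falsum => rfl
  | equal t₁ t₂ =>
    have hs : ∀ b, Dom Φ K (Sum.elim v xs b) := by rintro (b | i); exacts [hv b, hxs i]
    have h1 := (hA.map_term hs t₁).2
    have h2 := (hA.map_term hs t₂).2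
    rw [Sum.comp_elim] at h1 h2
    simp only [BoundedFormula.Realize, ← h1, ← h2, A.map_injective.eq_iff]
  | rel R ts =>
    have hs : ∀ b, Dom Φ K (Sum.elim v xs b) := by rintro (b | i); exacts [hv b, hxs i]
    have h1 := fun i => (hA.map_term hs (ts i)).2
    simp only [Sum.comp_elim] at h1
    simp only [BoundedFormula.Realize, ← h1]
    obtain ⟨⟩ | ⟨⟩ | ⟨⟩ := R
    · exact (A.O_map _).symm
    · exact (A.F_map _).symm
    · exact (A.E_map _ _).symm
  | imp φ ψ ih₁ ih₂ =>
    simp only [BoundedFormula.realize_imp, ih₁ hA hv hxs, ih₂ hA hv hxs]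
  | all φ ih =>
    simp only [BoundedFormula.realize_all]
    constructor
    -- A point of the target is reached by extending the inverse frame; the inverse `B.symm` of that
    -- extension agrees with `A` on the old domain.
    · intro h y
      obtain ⟨B, Φ', K', h1, h2, hB, hy, hBA⟩ := hA.symm.exists_extend hr y
      have hB' := hB.symm
      have hmap : ∀ x : Pt r, Dom Φ K x → B.symm.map x = (A.map x : Pt r') := by
        intro x hx
        have := hBA (A.map x) (dom_map_iff.2 hx)
        rw [symm_map_map] at this
        conv_lhs => rw [← this, symm_map_map]
      have hdom : ∀ x : Pt r', Dom Φ' K' x →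
          Dom (Φ'.map B.σ.toEmbedding) (K'.map B.τ.toEmbedding) (B.map x : Pt r) :=
        fun x hx => dom_map_iff.2 hx
      have hin : ∀ x : Pt r, Dom Φ K x →
          Dom (Φ'.map B.σ.toEmbedding) (K'.map B.τ.toEmbedding) x := by
        intro x hx
        rw [← B.map_symm_map (r := r') x]
        rw [hmap x hx]
        apply hdom
        refine Dom.mono h1 h2 (dom_map_iff.2 hx)
      have key := (ih hB' (xs := Fin.snoc xs (B.map y)) (fun b => hin _ (hv b)) ?_).1 (h _)
      · rw [Fin.comp_snoc, symm_map_map] at key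
        convert key using 1
        · funext b; exact (hmap _ (hv b)).symm
        · congr 1; funext b; exact (hmap _ (hxs b)).symm
      · intro i
        refine Fin.lastCases ?_ (fun i => ?_) i
        · simpa using hdom y hy
        · simpa using hin _ (hxs i)
    · intro h x
      obtain ⟨B, Φ', K', h1, h2, hB, hx, hBA⟩ := hA.exists_extend hr' x
      refine (ih hB (xs := Fin.snoc xs x) (fun b => (hv b).mono h1 h2) ?_).2 ?_
      · intro i
        refine Fin.lastCases ?_ (fun i => ?_) i
        · simpa using hx
        · simpa using (hxs i).mono h1 h2
      · rw [Fin.comp_snoc]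
        convert h (B.map x) using 1
        · funext b; exact hBA _ (hv b)
        · congr 1; funext b; exact hBA _ (hxs b)

theorem Good.formula_iff (hr : Generic r) (hr' : Generic r') {β : Type*}
    (φ : L₁.Formula β) {A : Frame} {Φ K : Finset ℕ} (hA : Good r r' A Φ K)
    {v : β → Pt r} (hv : ∀ b, Dom Φ K (v b)) :
    φ.Realize v ↔ φ.Realize (M := Pt r') (A.map ∘ v) := by
  have := hA.realize_iff hr hr' φ hv (xs := default) (fun i => i.elim0)
  rw [Formula.Realize, Formula.Realize, this]
  congr!

end Frame

/-! ### Embeddings and quantifier-free types. -/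

section Embedding

variable {M N : Type*} [L₁.Structure M] [L₁.Structure N]

theorem eval_map_embedding (g : M ↪[L₁] N) (x y : M) : eval (g x) (g y) = g (eval x y) := by
  rw [eval, eval, g.map_fun]
  congr 1
  funext i
  fin_cases i <;> rfl

theorem O_map_embedding (g : M ↪[L₁] N) (x : M) : O (g x) ↔ O x := by
  rw [O, O, ← g.map_rel]
  apply iff_of_eq; congr 1; funext i; fin_cases i; rfl

theorem F_map_embedding (g : M ↪[L₁] N) (x : M) : F (g x) ↔ F x := by
  rw [F, F, ← g.map_rel]
  apply iff_of_eq; congr 1; funext i; fin_cases i; rfl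

theorem E_map_embedding (g : M ↪[L₁] N) (x y : M) : E (g x) (g y) ↔ E x y := by
  rw [E, E, ← g.map_rel]
  apply iff_of_eq; congr 1; funext i; fin_cases i <;> rfl

theorem model_T₁_of_embedding (g : M ↪[L₁] N) (h : N ⊨ T₁) : M ⊨ T₁ := by
  rw [model_T₁_iff] at h ⊢
  obtain ⟨h1, h2, h3, h4, h5, h6, h7, h8⟩ := h
  simp only [← O_map_embedding g, ← F_map_embedding g, ← E_map_embedding g,
    ← g.injective.eq_iff, ← eval_map_embedding g]
  exact ⟨fun _ => h1 _, fun _ _ => h2 _ _, fun _ => h3 _, fun _ _ => h4 _ _, fun _ _ _ => h5 _ _ _,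
    fun _ _ => h6 _ _, fun _ _ _ => h7 _ _ _, fun _ _ => h8 _ _⟩

/-- An injective map that preserves the basic notions is an embedding. -/
def mkEmbedding (g : M → N) (hg : Function.Injective g) (hO : ∀ x, O (g x) ↔ O x)
    (hF : ∀ x, F (g x) ↔ F x) (hE : ∀ x y, E (g x) (g y) ↔ E x y)
    (hev : ∀ x y, g (eval x y) = eval (g x) (g y)) : M ↪[L₁] N where
  toFun := g
  inj' := hg
  map_fun' := by
    rintro n ⟨⟩ v
    have h1 : v = ![v 0, v 1] := by funext i; fin_cases i <;> rfl
    have h2 : g ∘ v = ![g (v 0), g (v 1)] := by funext i; fin_cases i <;> rfl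
    rw [h2, h1]
    exact hev _ _
  map_rel' := by
    rintro n (_ | _ | _) v
    · have h1 : v = ![v 0] := by funext i; fin_cases i; rfl
      have h2 : g ∘ v = ![g (v 0)] := by funext i; fin_cases i; rfl
      rw [h2, h1]
      exact hO _
    · have h1 : v = ![v 0] := by funext i; fin_cases i; rfl
      have h2 : g ∘ v = ![g (v 0)] := by funext i; fin_cases i; rfl
      rw [h2, h1]
      exact hF _
    · have h1 : v = ![v 0, v 1] := by funext i; fin_cases i <;> rfl
      have h2 : g ∘ v = ![g (v 0), g (v 1)] := by funext i; fin_cases i <;> rfl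
      rw [h2, h1]
      exact hE _ _

@[simp] theorem mkEmbedding_apply (g : M → N) (hg hO hF hE hev) (x : M) :
    mkEmbedding g hg hO hF hE hev x = g x := rfl

end Embedding

section AtomicType

variable {M N : Type*} [L₁.Structure M] [L₁.Structure N]

/-- The quantifier-free type of a tuple in a model of `T₁`. -/
def atomicType {ι : Type*} (u : ι → M) :
    (ι → Prop) × (ι → ι → Prop) × (ι → ι → ι → ι → Prop) :=
  (fun i => F (u i), fun i j => E (u i) (u j),
    fun i j k l => eval (u i) (u j) = eval (u k) (u l))

theorem atomicType_eq_iff {ι : Type*} {u : ι → M} {v : ι → N} :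
    atomicType u = atomicType v ↔ (∀ i, F (u i) ↔ F (v i)) ∧ (∀ i j, E (u i) (u j) ↔ E (v i) (v j)) ∧
      ∀ i j k l, eval (u i) (u j) = eval (u k) (u l) ↔ eval (v i) (v j) = eval (v k) (v l) := by
  simp only [atomicType, Prod.mk.injEq, funext_iff, eq_iff_iff]

theorem atomicType_comp_embedding {ι : Type*} (u : ι → M) (g : M ↪[L₁] N) :
    atomicType (fun i => g (u i)) = atomicType u := by
  simp only [atomicType_eq_iff, F_map_embedding, E_map_embedding, eval_map_embedding,
    g.injective.eq_iff, implies_true, and_self]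

end AtomicType

theorem exists_perm {ι : Type*} [Finite ι] (p q : ι → ℕ) (h : ∀ i j, p i = p j ↔ q i = q j) :
    ∃ g : Perm ℕ, ∀ i, g (p i) = q i := by
  obtain ⟨v, hv⟩ := Frame.exists_factor (p := p) (q := q) (fun i j => (h i j).1)
  obtain ⟨g, hg⟩ := Equiv.Perm.exists_extending_pair (fun x : Set.range p => x.1)
    (fun x : Set.range p => v x.1) Subtype.val_injective (by
      rintro ⟨_, i, rfl⟩ ⟨_, j, rfl⟩ hij
      simp only [hv] at hij
      exact Subtype.ext ((h i j).2 hij))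
  exact ⟨g, fun i => (hg ⟨p i, i, rfl⟩).trans (hv i)⟩

namespace Pt

variable {r r' : ℕ → ℕ → ℕ}

/-- The index of the class of an object. -/
def cls : Pt r → ℕ
  | obj κ _ => κ
  | fn _ => 0

/-- The index of a function, or of an object in its class. -/
def num : Pt r → ℕ
  | obj _ n => n
  | fn f => f

/-- Together with `Good.realize_iff` this is quantifier elimination: a finite tuple has its full
type determined by its quantifier-free type. -/
theorem exists_frame {ι : Type*} [Finite ι] {u : ι → Pt r} {u' : ι → Pt r'}
    (h : atomicType u = atomicType u') : ∃ (A : Frame) (Φ K : Finset ℕ),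
      A.Good r r' Φ K ∧ (∀ i, Frame.Dom Φ K (u i)) ∧ ∀ i, A.map (u i) = u' i := by
  classical
  have := Fintype.ofFinite ι
  obtain ⟨hF, hE, hev⟩ := atomicType_eq_iff.1 h
  -- Equality is read off from the values of `eval`, because `eval x x = x`.
  have heq : ∀ i j, u i = u j ↔ u' i = u' j := by
    have hd : ∀ {q} (x : Pt q), eval x x = x := by rintro q (_ | _) <;> simp
    intro i j
    have := hev i i j j
    rwa [hd, hd, hd, hd] at this
  have hobj : ∀ i κ n, u i = obj κ n → ∃ κ' n', u' i = obj κ' n' := by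
    intro i κ n hi
    have := hF i
    rcases h' : u' i with ⟨κ', n'⟩ | f
    · exact ⟨κ', n', rfl⟩
    · simp [hi, h'] at this
  have hfn : ∀ i f, u i = fn f → ∃ f', u' i = fn f' := by
    intro i f hi
    have := hF i
    rcases h' : u' i with ⟨κ', n'⟩ | f
    · simp [hi, h'] at this
    · exact ⟨f, rfl⟩
  obtain ⟨σ, hσ⟩ := exists_perm (ι := {i // F (u i)}) (fun i => num (u i)) (fun i => num (u' i)) (by
    rintro ⟨i, hi⟩ ⟨j, hj⟩
    rcases hi' : u i with _ | f
    · simp [hi'] at hi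
    rcases hj' : u j with _ | g
    · simp [hj'] at hj
    obtain ⟨f', hf'⟩ := hfn i f hi'
    obtain ⟨g', hg'⟩ := hfn j g hj'
    have := heq i j
    simp only [hi', hj', hf', hg', num, fn.injEq] at this ⊢
    exact this)
  obtain ⟨τ, hτ⟩ := exists_perm (ι := {i // O (u i)}) (fun i => cls (u i)) (fun i => cls (u' i)) (by
    rintro ⟨i, hi⟩ ⟨j, hj⟩
    rcases hi' : u i with ⟨κ, n⟩ | f
    swap
    · simp [hi'] at hi
    rcases hj' : u j with ⟨κ', n'⟩ | f
    swap
    · simp [hj'] at hj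
    obtain ⟨_, _, hf'⟩ := hobj i _ _ hi'
    obtain ⟨_, _, hg'⟩ := hobj j _ _ hj'
    have := hE i j
    simp only [hi', hj', hf', hg', cls, E_obj_obj] at this ⊢
    exact this)
  have hev' : ∀ i j κ n, eval (u i) (u j) = obj κ n →
      ∃ n', eval (u' i) (u' j) = obj (τ κ) n' := by
    intro i j κ n hij
    rcases hi : u i with ⟨κi, ni⟩ | f
    · obtain ⟨κ', n', hi'⟩ := hobj i _ _ hi
      have h1 := hτ ⟨i, by simp [hi]⟩
      simp only [hi, hi', cls, eval_obj, obj.injEq] at hij h1 ⊢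
      obtain ⟨rfl, rfl⟩ := hij
      exact ⟨n', h1.symm, rfl⟩
    · obtain ⟨f', hf'⟩ := hfn i _ hi
      rcases hj : u j with ⟨κj, nj⟩ | g
      · obtain ⟨κ', n', hj'⟩ := hobj j _ _ hj
        have h1 := hτ ⟨j, by simp [hj]⟩
        simp only [hi, hf', hj, hj', cls, eval_fn_obj, obj.injEq] at hij h1 ⊢
        obtain ⟨rfl, rfl⟩ := hij
        exact ⟨_, h1.symm, rfl⟩
      · simp [hi, hj] at hij
  -- In class `κ` the bijection must be right on all values `eval (u i) (u j)`. These include the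
  -- entries themselves, as `eval` returns an object in first position.
  have hh : ∀ κ, ∃ g : Perm ℕ, ∀ i j n, eval (u i) (u j) = obj κ n →
      eval (u' i) (u' j) = obj (τ κ) (g n) := by
    intro κ
    obtain ⟨g, hg⟩ := exists_perm (ι := {p : ι × ι // ∃ n, eval (u p.1) (u p.2) = obj κ n})
      (fun p => num (eval (u p.1.1) (u p.1.2))) (fun p => num (eval (u' p.1.1) (u' p.1.2))) (by
        rintro ⟨⟨i, j⟩, n, hn⟩ ⟨⟨k, l⟩, m, hm⟩
        obtain ⟨n', hn'⟩ := hev' _ _ _ _ hn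
        obtain ⟨m', hm'⟩ := hev' _ _ _ _ hm
        have := hev i j k l
        simp only at hn hm hn' hm'
        simp only [hn, hm, hn', hm', num, obj.injEq, true_and] at this ⊢
        exact this)
    refine ⟨g, fun i j n hn => ?_⟩
    obtain ⟨n', hn'⟩ := hev' _ _ _ _ hn
    have := hg ⟨(i, j), n, hn⟩
    simp only [hn, hn', num] at this
    rw [hn', this]
  choose g hg using hh
  have hmap : ∀ i, (⟨σ, τ, g⟩ : Frame).map (u i) = u' i := by
    intro i
    rcases hi : u i with ⟨κ, n⟩ | f
    · have := hg κ i i n (by simp [hi])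
      obtain ⟨κ', n', hi'⟩ := hobj i _ _ hi
      simp only [hi', eval_obj] at this
      simp [hi', this]
    · obtain ⟨f', hf'⟩ := hfn i _ hi
      have := hσ ⟨i, by simp [hi]⟩
      simp only [hi, hf', num] at this
      simp [hf', this]
  refine ⟨⟨σ, τ, g⟩, (Finset.univ.filter fun i => F (u i)).image fun i => num (u i),
    (Finset.univ.filter fun i => O (u i)).image fun i => cls (u i), ?_, fun i => ?_, hmap⟩
  · intro f hf κ hκ
    simp only [Finset.mem_image, Finset.mem_filter, Finset.mem_univ, true_and] at hf hκ
    obtain ⟨i, hi, rfl⟩ := hf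
    obtain ⟨j, hj, rfl⟩ := hκ
    rcases hi' : u i with _ | f
    · simp [hi'] at hi
    rcases hj' : u j with ⟨κ, n⟩ | f'
    swap
    · simp [hj'] at hj
    have h1 := hmap i
    have h2 := hmap j
    have h3 := hg κ i j (r f κ) (by simp [hi', hj'])
    rw [← h1, ← h2, hi', hj'] at h3
    simpa [num, cls] using h3
  · rcases hi : u i with ⟨κ, n⟩ | f
    · simp only [Frame.dom_obj, Finset.mem_image, Finset.mem_filter, Finset.mem_univ, true_and]
      exact ⟨i, by simp [hi], by simp [hi, cls]⟩
    · simp only [Frame.dom_fn, Finset.mem_image, Finset.mem_filter, Finset.mem_univ, true_and]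
      exact ⟨i, by simp [hi], by simp [hi, num]⟩

end Pt

/-! ### Coherent families of frames. -/

namespace Frame

open Pt

variable {r r' : ℕ → ℕ → ℕ} {S : Type*}

/-- `obj κ n` is in `X`, or it is a value of a function in `X`. -/
def Relevant (X : Set (Pt r)) (κ n : ℕ) : Prop :=
  obj κ n ∈ X ∨ ∃ f, fn f ∈ X ∧ n = r f κ

/-- Conditions under which the elements of `X` outside the domains of a finite family of frames can
be added to these domains, with the same images. -/
structure Coherent (r' : ℕ → ℕ → ℕ) (X : Set (Pt r)) (A : S → Frame) (Φ K : S → Finset ℕ) :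
    Prop where
  good : ∀ s, Good r r' (A s) (Φ s) (K s)
  eq_of_fn : ∀ s s', ∀ f ∈ Φ s, ∀ f' ∈ Φ s', (A s).σ f = (A s').σ f' → f = f'
  eq_of_class : ∀ s s', ∀ κ ∈ K s, ∀ κ' ∈ K s', (A s).τ κ = (A s').τ κ' → κ = κ'
  eq_on_relevant : ∀ s s', ∀ κ ∈ K s, κ ∈ K s' → (A s).τ κ = (A s').τ κ →
    ∀ n, Relevant X κ n → (A s).h κ n = (A s').h κ n

/-- The point `x` is in the domain of all frames of the family, with the same image. -/
def Settled (r' : ℕ → ℕ → ℕ) (A : S → Frame) (Φ K : S → Finset ℕ) (x : Pt r) : Prop :=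
  (∀ s, Dom (Φ s) (K s) x) ∧ ∀ s s', ((A s).map x : Pt r') = (A s').map x

/-- A class is added as a whole, so settling one object also settles the rest of its class. The last
clause records that every other outside point remains eligible for later steps. -/
theorem Coherent.exists_settle [Finite S] (hr' : Generic r') {X : Set (Pt r)} {A : S → Frame}
    {Φ K : S → Finset ℕ} (h : Coherent r' X A Φ K) {x : Pt r} (hxX : x ∈ X)
    (hx : Settled r' A Φ K x ∨ ∀ s, ¬ Dom (Φ s) (K s) x) :
    ∃ (B : S → Frame) (Φ' K' : S → Finset ℕ), Coherent r' X B Φ' K' ∧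
      (∀ s, ∀ y : Pt r, Dom (Φ s) (K s) y → Dom (Φ' s) (K' s) y ∧ ((B s).map y : Pt r') = (A s).map y) ∧
      Settled r' B Φ' K' x ∧
      ∀ y : Pt r, (∀ s, ¬ Dom (Φ s) (K s) y) →
        Settled r' B Φ' K' y ∨ ∀ s, ¬ Dom (Φ' s) (K' s) y := by
  classical
  rcases hx with hx | hx
  · exact ⟨A, Φ, K, h, fun s y hy => ⟨hy, rfl⟩, hx, fun y hy => Or.inr hy⟩
  have := Fintype.ofFinite S
  rcases x with ⟨κ, n⟩ | f
  · simp only [dom_obj] at hx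
    -- Taking all current images as the forbidden set keeps distinct classes from acquiring the same
    -- image in different frames.
    obtain ⟨κ', hκ', g, B, hB⟩ := exists_extend_class hr' A Φ K h.good κ hx h.eq_of_fn
      (Finset.univ.biUnion fun s => (K s).map (A s).τ.toEmbedding)
    simp only [Finset.mem_biUnion, Finset.mem_univ, true_and, Finset.mem_map, toEmbedding_apply,
      not_exists, not_and] at hκ'
    choose hσ hτκ hgκ hτ hh hgood using hB
    have hset : ∀ n, Settled r' B Φ (fun s => insert κ (K s)) (obj κ n : Pt r) := fun n =>
      ⟨fun s => by simp, fun s s' => by simp [hτκ, hgκ]⟩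
    refine ⟨B, Φ, fun s => insert κ (K s), ⟨hgood, ?_, ?_, ?_⟩, ?_, hset n, ?_⟩
    · intro s s' f hf f' hf'
      rw [hσ, hσ]
      exact h.eq_of_fn s s' f hf f' hf'
    · intro s s' i h₁ i' h₂ he
      rcases Finset.mem_insert.1 h₁ with rfl | hi <;> rcases Finset.mem_insert.1 h₂ with rfl | hi'
      · rfl
      · rw [hτκ, hτ _ _ hi'] at he
        exact absurd he.symm (hκ' s' i' hi')
      · rw [hτκ, hτ _ _ hi] at he
        exact absurd he (hκ' s i hi)
      · rw [hτ _ _ hi, hτ _ _ hi'] at he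
        exact h.eq_of_class s s' i hi i' hi' he
    · intro s s' i hi hi' he m hm
      by_cases hik : i = κ
      · rw [hik, hgκ, hgκ]
      · have hi := Finset.mem_of_mem_insert_of_ne hi hik
        have hi' := Finset.mem_of_mem_insert_of_ne hi' hik
        rw [hτ _ _ hi, hτ _ _ hi'] at he
        rw [hh _ _ hi, hh _ _ hi']
        exact h.eq_on_relevant s s' i hi hi' he m hm
    · rintro s (⟨i, m⟩ | f) hy
      · exact ⟨Finset.mem_insert_of_mem hy, by simp [hτ s i hy, hh s i hy]⟩
      · exact ⟨hy, by simp [hσ]⟩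
    · rintro (⟨i, m⟩ | f) hy
      · by_cases hi : i = κ
        · subst hi
          exact Or.inl (hset m)
        · exact Or.inr fun s => by simpa [hi] using hy s
      · exact Or.inr hy
  · simp only [dom_fn] at hx
    -- Two frames that send a class to the same place must demand the same value there from the
    -- image of `f`. This is why values of functions in `X` count as relevant.
    obtain ⟨f', hf', B, hB⟩ := exists_extend_fn hr' A Φ K h.good f hx (by
        intro s s' κ hκ κ' hκ' he
        obtain rfl := h.eq_of_class s s' κ hκ κ' hκ' he
        exact h.eq_on_relevant s s' κ hκ hκ' he _ (Or.inr ⟨f, hxX, rfl⟩))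
      (Finset.univ.biUnion fun s => (Φ s).map (A s).σ.toEmbedding)
    simp only [Finset.mem_biUnion, Finset.mem_univ, true_and, Finset.mem_map, toEmbedding_apply,
      not_exists, not_and] at hf'
    choose hτ hh hσf hσ hgood using hB
    have hset : Settled r' B (fun s => insert f (Φ s)) K (fn f : Pt r) :=
      ⟨fun s => by simp, fun s s' => by simp [hσf]⟩
    refine ⟨B, fun s => insert f (Φ s), K, ⟨hgood, ?_, ?_, ?_⟩, ?_, hset, ?_⟩
    · intro s s' i h₁ i' h₂ he
      rcases Finset.mem_insert.1 h₁ with rfl | hi <;> rcases Finset.mem_insert.1 h₂ with rfl | hi'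
      · rfl
      · rw [hσf, hσ _ _ hi'] at he
        exact absurd he.symm (hf' s' i' hi')
      · rw [hσf, hσ _ _ hi] at he
        exact absurd he (hf' s i hi)
      · rw [hσ _ _ hi, hσ _ _ hi'] at he
        exact h.eq_of_fn s s' i hi i' hi' he
    · intro s s'
      rw [hτ, hτ]
      exact h.eq_of_class s s'
    · intro s s'
      rw [hτ, hτ, hh, hh]
      exact h.eq_on_relevant s s'
    · rintro s (⟨i, m⟩ | i) hy
      · exact ⟨hy, by simp [hτ, hh]⟩
      · exact ⟨Finset.mem_insert_of_mem hy, by simp [hσ s i hy]⟩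
    · rintro (⟨i, m⟩ | i) hy
      · exact Or.inr hy
      · by_cases hi : i = f
        · subst hi
          exact Or.inl hset
        · exact Or.inr fun s => by simpa [hi] using hy s

theorem Coherent.exists_settle_all [Finite S] (hr' : Generic r') {X : Set (Pt r)} (hX : X.Finite)
    {A : S → Frame} {Φ K : S → Finset ℕ} (h : Coherent r' X A Φ K) (Y : Set (Pt r)) (hYX : Y ⊆ X)
    (hY : ∀ x ∈ Y, Settled r' A Φ K x ∨ ∀ s, ¬ Dom (Φ s) (K s) x) :
    ∃ (B : S → Frame) (Φ' K' : S → Finset ℕ), Coherent r' X B Φ' K' ∧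
      (∀ s, ∀ y : Pt r, Dom (Φ s) (K s) y → Dom (Φ' s) (K' s) y ∧ ((B s).map y : Pt r') = (A s).map y) ∧
      ∀ x ∈ Y, Settled r' B Φ' K' x := by
  induction Y, hX.subset hYX using Set.Finite.induction_on generalizing A Φ K with
  | empty => exact ⟨A, Φ, K, h, fun s y hy => ⟨hy, rfl⟩, by simp⟩
  | @insert x Y hx _ ih =>
    obtain ⟨B, Φ', K', hB, hBA, hxB, hYB⟩ := h.exists_settle hr' (hYX (Set.mem_insert _ _))
      (hY x (Set.mem_insert _ _))
    obtain ⟨B', Φ'', K'', hB', hBB, hYB'⟩ := ih hB ((Set.subset_insert _ _).trans hYX) (by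
      intro y hy
      rcases hY y (Set.mem_insert_of_mem _ hy) with hs | hn
      · exact Or.inl ⟨fun s => (hBA s y (hs.1 s)).1, fun s s' => by
          rw [(hBA s y (hs.1 s)).2, (hBA s' y (hs.1 s')).2, hs.2 s s']⟩
      · exact hYB y hn)
    refine ⟨B', Φ'', K'', hB', fun s y hy => ⟨(hBB s y (hBA s y hy).1).1, ?_⟩, ?_⟩
    · rw [(hBB s y (hBA s y hy).1).2, (hBA s y hy).2]
    · rintro y (rfl | hy)
      · exact ⟨fun s => (hBB s y (hxB.1 s)).1, fun s s' => by
          rw [(hBB s y (hxB.1 s)).2, (hBB s' y (hxB.1 s')).2, hxB.2 s s']⟩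
      · exact hYB' y hy

end Frame

/-! ### Embedding models of `T₁` into some `Pt r`. -/

section Coordinates

open Pt

variable {N : Type*} [L₁.Structure N]

/-- The table `r` is read off from `eval`; it is well defined because a selected value depends only
on the function and the class. -/
theorem exists_embedding_of_coordinates (hN : N ⊨ T₁) (cl nu : N → ℕ)
    (hcl : ∀ x y, O x → O y → (cl x = cl y ↔ E x y))
    (hnuE : ∀ x y, E x y → nu x = nu y → x = y) (hnuF : ∀ x y, F x → F y → nu x = nu y → x = y) :
    ∃ (r : ℕ → ℕ → ℕ) (g : N ↪[L₁] Pt r), (∀ x, O x → g x = obj (cl x) (nu x)) ∧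
      ∀ x, F x → g x = fn (nu x) := by
  classical
  obtain ⟨h1, h2, h3, h4, h5, h6, h7, h8⟩ := (model_T₁_iff N).1 hN
  obtain ⟨v, hv⟩ := Frame.exists_factor (ι := {p : N × N // F p.1 ∧ O p.2})
    (p := fun p => Nat.pair (nu p.1.1) (cl p.1.2)) (q := fun p => nu (eval p.1.1 p.1.2)) (by
      rintro ⟨⟨x, y⟩, hx, hy⟩ ⟨⟨x', y'⟩, hx', hy'⟩ h
      obtain ⟨h, h'⟩ := Nat.pair_eq_pair.1 h
      obtain rfl := hnuF _ _ hx hx' h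
      have := h7 x y y' hx ((hcl _ _ hy hy').1 h')
      simp only [this])
  have hOF : ∀ x : N, ¬ O x → F x := fun x hx => by
    by_contra h
    exact hx ((h1 x).2 h)
  have hFO : ∀ x : N, F x → ¬ O x := fun x hx h => (h1 x).1 h hx
  let g : N → Pt (fun f κ => v (Nat.pair f κ)) := fun x =>
    if O x then obj (cl x) (nu x) else fn (nu x)
  have gO : ∀ x, O x → g x = obj (cl x) (nu x) := fun x hx => if_pos hx
  have gF : ∀ x, F x → g x = fn (nu x) := fun x hx => if_neg (hFO x hx)
  refine ⟨fun f κ => v (Nat.pair f κ), mkEmbedding g ?_ ?_ ?_ ?_ ?_, gO, gF⟩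
  · intro x y hxy
    by_cases hx : O x <;> by_cases hy : O y
    · rw [gO x hx, gO y hy, obj.injEq, hcl x y hx hy] at hxy
      exact hnuE x y hxy.1 hxy.2
    · rw [gO x hx, gF y (hOF y hy)] at hxy
      cases hxy
    · rw [gF x (hOF x hx), gO y hy] at hxy
      cases hxy
    · rw [gF x (hOF x hx), gF y (hOF y hy), fn.injEq] at hxy
      exact hnuF x y (hOF x hx) (hOF y hy) hxy
  · intro x
    by_cases hx : O x
    · simp [gO x hx, hx]
    · simp [gF x (hOF x hx), hx]
  · intro x
    by_cases hx : O x
    · simp [gO x hx, (h1 x).1 hx]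
    · simp [gF x (hOF x hx), hOF x hx]
  · intro x y
    by_cases hx : O x
    swap
    · simpa [gF x (hOF x hx)] using fun h => hx (h2 x y h).1
    by_cases hy : O y
    swap
    · simpa [gF y (hOF y hy)] using fun h => hy (h2 x y h).2
    rw [gO x hx, gO y hy, E_obj_obj, hcl x y hx hy]
  · intro x y
    by_cases hx : O x
    · rw [h8 x y (fun h => hFO x h.1 hx), gO x hx, eval_obj]
    have hx := hOF x hx
    by_cases hy : O y
    swap
    · rw [h8 x y (fun h => hy h.2), gF x hx, gF y (hOF y hy), eval_fn_fn]
    have hE := h6 x y hx hy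
    have hO := (h2 _ _ hE).1
    rw [gO _ hO, gF x hx, gO y hy, eval_fn_obj, (hcl _ _ hO hy).2 hE]
    exact congrArg _ (hv ⟨(x, y), hx, hy⟩).symm

theorem exists_embedding_of_countable [Countable N] (hN : N ⊨ T₁) :
    ∃ r : ℕ → ℕ → ℕ, Nonempty (N ↪[L₁] Pt r) := by
  obtain ⟨h1, h2, h3, h4, h5, h6, h7, h8⟩ := (model_T₁_iff N).1 hN
  obtain ⟨nu, hnu⟩ := exists_injective_nat N
  -- Equality is added because `E` is not reflexive on functions.
  let s : Setoid N := ⟨fun x y => x = y ∨ E x y, fun x => Or.inl rfl,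
    fun {x y} h => h.elim (fun h => Or.inl h.symm) (fun h => Or.inr (h4 _ _ h)),
    fun {x y z} h h' => by
      rcases h with rfl | h
      · exact h'
      · rcases h' with rfl | h'
        · exact Or.inr h
        · exact Or.inr (h5 _ _ _ h h')⟩
  obtain ⟨r, g, -⟩ := exists_embedding_of_coordinates hN
    (fun x => nu (Quotient.mk s x).out) nu (by
      intro x y hx hy
      rw [hnu.eq_iff, Quotient.out_inj, Quotient.eq]
      constructor
      · rintro (rfl | h)
        exacts [h3 _ hx, h]
      · exact Or.inr) (fun x y _ h => hnu h) (fun x y _ _ h => hnu h)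
  exact ⟨r, ⟨g⟩⟩

end Coordinates

/-! ### Closure under `eval` and the Fraïssé limit. -/

namespace Pt

variable {r r' : ℕ → ℕ → ℕ}

/-- The closure of a set under `eval`. -/
def cl (X : Set (Pt r)) : Set (Pt r) := X ∪ Set.image2 eval X X

theorem subset_cl (X : Set (Pt r)) : X ⊆ cl X := Set.subset_union_left

theorem cl_finite {X : Set (Pt r)} (hX : X.Finite) : (cl X).Finite := hX.union (hX.image2 _ hX)

theorem fn_mem_cl {X : Set (Pt r)} {f : ℕ} : (fn f : Pt r) ∈ cl X ↔ fn f ∈ X := by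
  refine ⟨?_, fun h => subset_cl X h⟩
  rintro (h | ⟨x, hx, y, hy, h⟩)
  · exact h
  · rcases x with ⟨κ, n⟩ | g <;> rcases y with ⟨κ', n'⟩ | g' <;> simp at h
    exact h ▸ hx

theorem exists_obj_of_mem_cl {X : Set (Pt r)} {κ n : ℕ} (h : (obj κ n : Pt r) ∈ cl X) :
    ∃ m, (obj κ m : Pt r) ∈ X := by
  rcases h with h | ⟨x, hx, y, hy, h⟩
  · exact ⟨n, h⟩
  · rcases x with ⟨κ', m⟩ | g <;> rcases y with ⟨κ'', m'⟩ | g' <;> simp at h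
    · exact ⟨m, h.1 ▸ hx⟩
    · exact ⟨m, h.1 ▸ hx⟩
    · exact ⟨m', h.1 ▸ hy⟩

/-- One round of `eval` suffices: it creates no functions and meets no new classes, and the value on
a class can be computed at any of its elements. -/
theorem eval_mem_cl {X : Set (Pt r)} {x y : Pt r} (hx : x ∈ cl X) (hy : y ∈ cl X) :
    eval x y ∈ cl X := by
  rcases x with ⟨κ, n⟩ | f
  · simpa using hx
  · rcases y with ⟨κ, n⟩ | g
    · obtain ⟨m, hm⟩ := exists_obj_of_mem_cl hy
      exact Or.inr ⟨_, fn_mem_cl.1 hx, _, hm, by simp⟩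
    · simpa using hx

theorem value_mem_cl {X : Set (Pt r)} {f κ n : ℕ} (hf : (fn f : Pt r) ∈ cl X)
    (hκ : (obj κ n : Pt r) ∈ cl X) : (obj κ (r f κ) : Pt r) ∈ cl X :=
  eval_mem_cl hf hκ

/-- A set closed under `eval`, as a substructure. -/
def substructureOf (X : Set (Pt r)) (hX : ∀ x ∈ X, ∀ y ∈ X, eval x y ∈ X) :
    L₁.Substructure (Pt r) where
  carrier := X
  fun_mem := by
    rintro n ⟨⟩ v hv
    exact hX _ (hv 0) _ (hv 1)

theorem finite_of_fg {S : L₁.Substructure (Pt r)} (hS : S.FG) : (S : Set (Pt r)).Finite := by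
  obtain ⟨t, rfl⟩ := hS
  refine (cl_finite t.finite_toSet).subset (?_ : _ ≤ substructureOf (cl (t : Set (Pt r)))
    fun x hx y hy => eval_mem_cl hx hy)
  exact Substructure.closure_le.2 (subset_cl _)

end Pt

namespace Frame

open Pt

variable {r r' : ℕ → ℕ → ℕ}

/-- The embedding given by a good frame. -/
def Good.embedding {A : Frame} {Φ K : Finset ℕ} (hA : Good r r' A Φ K) :
    (substructureOf {x : Pt r | Dom Φ K x} fun _ hx _ hy => Dom.eval hx hy) ↪[L₁] Pt r' :=
  mkEmbedding (fun x => A.map x.1) (A.map_injective.comp Subtype.val_injective)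
    (fun x => (A.O_map x.1).trans (O_map_embedding (Substructure.subtype _) x))
    (fun x => (A.F_map x.1).trans (F_map_embedding (Substructure.subtype _) x))
    (fun x y => (A.E_map x.1 y.1).trans (E_map_embedding (Substructure.subtype _) x y))
    (fun x y => hA.map_eval x.2 y.2)

end Frame

-- By the one-point extension criterion: an isomorphism of finite substructures comes from a good
-- frame, which is extended to the new point and then restricted.
open Pt in
theorem Generic.isUltrahomogeneous {r : ℕ → ℕ → ℕ} (hr : Generic r) :
    L₁.IsUltrahomogeneous (Pt r) := by
  rw [isUltrahomogeneous_iff_IsExtensionPair Structure.cg_of_countable,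
    isExtensionPair_iff_exists_embedding_closure_singleton_sup]
  intro S hS f m
  have : Finite S := finite_of_fg hS
  obtain ⟨A, Φ, K, hA, hdom, hmap⟩ := exists_frame (u := fun x : S => x.1) (u' := fun x : S => f x)
    ((atomicType_comp_embedding id (Substructure.subtype S)).trans
      (atomicType_comp_embedding id f).symm)
  obtain ⟨B, Φ', K', h1, h2, hB, hm, hBA⟩ := hA.exists_extend hr m
  refine ⟨hB.embedding.comp (Substructure.inclusion (sup_le ?_ ?_)), ?_⟩
  · exact Substructure.closure_le.2 (Set.singleton_subset_iff.2 hm)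
  · exact fun x hx => (hdom ⟨x, hx⟩).mono h1 h2
  · ext x
    exact ((hBA _ (hdom x)).trans (hmap x)).symm

-- After embedding `N` into some `Pt q`, a single frame with empty domain is extended until all of
-- `N` is settled.
open Selector.Frame in
theorem Generic.exists_embedding {r : ℕ → ℕ → ℕ} (hr : Generic r) {N : Type*} [L₁.Structure N]
    [Finite N] (hN : N ⊨ T₁) : Nonempty (N ↪[L₁] Pt r) := by
  obtain ⟨q, ⟨g⟩⟩ := exists_embedding_of_countable hN
  have hc : Coherent r (Set.range g) (fun _ : Unit => refl) (fun _ => ∅) (fun _ => ∅) :=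
    ⟨fun _ => by simp [Good], by simp, by simp, by simp⟩
  obtain ⟨B, Φ', K', hB, -, hset⟩ := hc.exists_settle_all hr (Set.finite_range g) (Set.range g)
    subset_rfl (fun x _ => Or.inr fun _ => by cases x <;> simp)
  refine ⟨mkEmbedding (fun x => (B ()).map (g x)) ((B ()).map_injective.comp g.injective)
    (fun x => ((B ()).O_map _).trans (O_map_embedding g x))
    (fun x => ((B ()).F_map _).trans (F_map_embedding g x))
    (fun x y => ((B ()).E_map _ _).trans (E_map_embedding g x y)) fun x y => ?_⟩
  rw [← eval_map_embedding g]
  exact (hB.good ()).map_eval ((hset _ ⟨x, rfl⟩).1 ()) ((hset _ ⟨y, rfl⟩).1 ())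

theorem Generic.isFraisseLimit {r : ℕ → ℕ → ℕ} (hr : Generic r) : IsFraisseLimit K₁ (Pt r) where
  ultrahomogeneous := hr.isUltrahomogeneous
  age := by
    ext N
    constructor
    · rintro ⟨hN, ⟨g⟩⟩
      refine ⟨?_, model_T₁_of_embedding g (Pt.model_T₁ r)⟩
      have := (Pt.finite_of_fg (hN.range g.toHom)).to_subtype
      exact Finite.of_injective (fun x => (⟨g x, x, rfl⟩ : (g.toHom.range : Set (Pt r))))
        (fun x y hxy => g.injective (congrArg Subtype.val hxy))
    · rintro ⟨hfin, hN⟩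
      exact ⟨Structure.FG.of_finite, hr.exists_embedding hN⟩

/-! ### An explicit generic function. -/

/-- The `k`-th finitely supported function. -/
def decodeFun (k i : ℕ) : ℕ := (Denumerable.ofNat (List ℕ) k).getD i 0

theorem exists_decodeFun (v : ℕ → ℕ) (N : ℕ) : ∃ k, ∀ i < N, decodeFun k i = v i :=
  ⟨Encodable.encode ((List.range N).map v), fun i hi => by simp [decodeFun, hi]⟩

/-- An explicit generic function. -/
def explicitValue (f κ : ℕ) : ℕ :=
  if f < κ then decodeFun κ.unpair.2 f else decodeFun f.unpair.2 κ

/-- The larger index decides the value. An index `c` above `Φ ∪ K` whose second component codes `v`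
therefore serves both as the new function and as the new class. -/
theorem generic_explicitValue : Generic explicitValue := by
  have key : ∀ (Φ K : Finset ℕ) (v : ℕ → ℕ), ∃ c, (∀ i ∈ Φ, i < c) ∧ (∀ i ∈ K, i < c) ∧
      (∀ i ∈ Φ, decodeFun c.unpair.2 i = v i) ∧ ∀ i ∈ K, decodeFun c.unpair.2 i = v i := by
    intro Φ K v
    have hN : ∀ i ∈ Φ ∪ K, i < (Φ ∪ K).sup id + 1 := fun i hi =>
      Nat.lt_succ_of_le (Finset.le_sup (f := id) hi)
    obtain ⟨k, hk⟩ := exists_decodeFun v ((Φ ∪ K).sup id + 1)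
    refine ⟨Nat.pair ((Φ ∪ K).sup id + 1) k, fun i hi => ?_, fun i hi => ?_, fun i hi => ?_,
      fun i hi => ?_⟩
    · exact (hN i (Finset.mem_union_left _ hi)).trans_le (Nat.left_le_pair _ _)
    · exact (hN i (Finset.mem_union_right _ hi)).trans_le (Nat.left_le_pair _ _)
    · simpa using hk i (hN i (Finset.mem_union_left _ hi))
    · simpa using hk i (hN i (Finset.mem_union_right _ hi))
  constructor
  · intro Φ K v
    obtain ⟨c, h1, h2, h3, h4⟩ := key Φ K v
    refine ⟨c, fun h => (h1 c h).false, fun κ hκ => ?_⟩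
    rw [explicitValue, if_neg (h2 κ hκ).not_gt, h4 κ hκ]
  · intro Φ K v
    obtain ⟨c, h1, h2, h3, h4⟩ := key Φ K v
    refine ⟨c, fun h => (h2 c h).false, 1, fun f hf => ?_⟩
    rw [explicitValue, if_pos (h1 f hf), h3 f hf, Perm.one_apply]

/-! ### First-order axioms and countable models. -/

/-- The first-order axioms (schemes) of the Fraïssé limit, apart from those of `T₁`. -/
structure GenericAxioms (M : Type) [L₁.Structure M] : Prop where
  exists_obj : ∀ (Z : Type) [Finite Z] (z : Z → M) (b : M), O b → ∃ y, E y b ∧ ∀ i, y ≠ z i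
  exists_fn : ∀ (X Z : Type) [Finite X] [Finite Z] (x : X → M) (z : Z → M),
    ((∀ i, O (x i)) ∧ ∀ i j, i ≠ j → ¬ E (x i) (x j)) →
      ∃ y, F y ∧ (∀ i, y ≠ z i) ∧ ∀ i, eval y (x i) = x i
  exists_class : ∀ (X Z : Type) [Finite X] [Finite Z] (s : X → ℕ) (x : X → M) (z : Z → M),
    ((∀ i, F (x i)) ∧ ∀ i j, i ≠ j → x i ≠ x j) →
      ∃ y, O y ∧ (∀ i, ¬ E y (z i)) ∧
        ∀ i j, s i = s j ↔ eval (x i) y = eval (x j) y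

section Transfer

variable {M N : Type*} [L₁.Structure M] [L₁.Structure N]

theorem model_iAlls_iff {α : Type} [Finite α] (θ : L₁.Formula α) :
    M ⊨ (Formula.iAlls α (θ.relabel Sum.inr : L₁.Formula (Empty ⊕ α)) : L₁.Sentence) ↔
      ∀ v : α → M, θ.Realize v := by
  rw [Sentence.Realize, Formula.realize_iAlls]
  simp only [Formula.realize_relabel]
  rfl

theorem realize_of_completeTheory [N ⊨ L₁.completeTheory M] {α : Type} [Finite α]
    (θ : L₁.Formula α) (h : ∀ v : α → M, θ.Realize v) (v : α → N) : θ.Realize v :=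
  (model_iAlls_iff θ).1
    ((realize_iff_of_model_completeTheory M N _).2 ((model_iAlls_iff θ).2 h)) v

variable {α : Type}

/-- The formula `O(a)`. -/
def fO (a : α) : L₁.Formula α := isO (Term.var (Sum.inl a))
/-- The formula `F(a)`. -/
def fF (a : α) : L₁.Formula α := isF (Term.var (Sum.inl a))
/-- The formula `E(a, b)`. -/
def fE (a b : α) : L₁.Formula α := relE (Term.var (Sum.inl a)) (Term.var (Sum.inl b))
/-- The term `eval(a, b)`. -/
def tEval (a b : α) : L₁.Term α := Functions.apply₂ symEval (Term.var a) (Term.var b)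

@[simp] theorem realize_fO (a : α) (v : α → M) : (fO a).Realize v ↔ O (v a) := by
  simp [fO, isO, O, Formula.Realize, BoundedFormula.realize_rel₁]
@[simp] theorem realize_fF (a : α) (v : α → M) : (fF a).Realize v ↔ F (v a) := by
  simp [fF, isF, F, Formula.Realize, BoundedFormula.realize_rel₁]
@[simp] theorem realize_fE (a b : α) (v : α → M) : (fE a b).Realize v ↔ E (v a) (v b) := by
  simp [fE, relE, E, Formula.Realize, BoundedFormula.realize_rel₂]
@[simp] theorem realize_tEval (a b : α) (v : α → M) : (tEval a b).realize v = eval (v a) (v b) := by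
  simp [tEval, eval]

end Transfer

/-- For fixed finite index types each scheme is the universal closure of one formula `θ`. -/
theorem GenericAxioms.of_completeTheory {M N : Type} [L₁.Structure M] [L₁.Structure N]
    [N ⊨ L₁.completeTheory M] (h : GenericAxioms M) : GenericAxioms N where
  exists_obj Z _ z b hb := by
    let θ : L₁.Formula (Z ⊕ Unit) := (fO (Sum.inr ())).imp (Formula.iExs Unit
      (fE (Sum.inr ()) (Sum.inl (Sum.inr ())) ⊓ Formula.iInf fun i : Z =>
        ∼(Term.equal (Term.var (Sum.inr ())) (Term.var (Sum.inl (Sum.inl i))))))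
    have hθ : ∀ {P : Type} [L₁.Structure P] (v : Z ⊕ Unit → P), θ.Realize v ↔
        (O (v (Sum.inr ())) → ∃ y, E y (v (Sum.inr ())) ∧ ∀ i, y ≠ v (Sum.inl i)) := by
      intro P _ v
      simp only [θ, Formula.realize_imp, realize_fO, Formula.realize_iExs, Formula.realize_inf,
        realize_fE, Formula.realize_iInf, Formula.realize_not, Formula.realize_equal,
        Term.realize_var, Sum.elim_inl, Sum.elim_inr]
      exact imp_congr_right fun _ => ⟨fun ⟨y, hy⟩ => ⟨y (), hy⟩, fun ⟨y, hy⟩ => ⟨fun _ => y, hy⟩⟩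
    exact (hθ _).1 (realize_of_completeTheory (M := M) θ
      (fun v => (hθ v).2 (h.exists_obj Z _ _)) (Sum.elim z fun _ => b)) hb
  exists_fn X Z _ _ x z hx := by
    let θ : L₁.Formula (X ⊕ Z) := ((Formula.iInf fun i : X => fO (Sum.inl i)) ⊓
        Formula.iInf fun p : {p : X × X // p.1 ≠ p.2} =>
          ∼(fE (Sum.inl p.1.1) (Sum.inl p.1.2))).imp (Formula.iExs Unit
      (fF (Sum.inr ()) ⊓ ((Formula.iInf fun i : Z =>
        ∼(Term.equal (Term.var (Sum.inr ())) (Term.var (Sum.inl (Sum.inr i))))) ⊓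
        Formula.iInf fun i : X => Term.equal (tEval (Sum.inr ()) (Sum.inl (Sum.inl i)))
          (Term.var (Sum.inl (Sum.inl i))))))
    have hθ : ∀ {P : Type} [L₁.Structure P] (v : X ⊕ Z → P), θ.Realize v ↔
        (((∀ i, O (v (Sum.inl i))) ∧ ∀ i j, i ≠ j → ¬ E (v (Sum.inl i)) (v (Sum.inl j))) →
          ∃ y, F y ∧ (∀ i, y ≠ v (Sum.inr i)) ∧ ∀ i, eval y (v (Sum.inl i)) = v (Sum.inl i)) := by
      intro P _ v
      simp only [θ, Formula.realize_imp, realize_fO, realize_fF, Formula.realize_iExs,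
        Formula.realize_inf, realize_fE, Formula.realize_iInf, Formula.realize_not,
        Formula.realize_equal, Term.realize_var, Sum.elim_inl, Sum.elim_inr, realize_tEval,
        Subtype.forall, Prod.forall]
      exact imp_congr_right fun _ => ⟨fun ⟨y, hy⟩ => ⟨y (), hy⟩, fun ⟨y, hy⟩ => ⟨fun _ => y, hy⟩⟩
    exact (hθ _).1 (realize_of_completeTheory (M := M) θ
      (fun v => (hθ v).2 (h.exists_fn X Z _ _)) (Sum.elim x z)) hx
  exists_class X Z _ _ s x z hx := by
    let θ : L₁.Formula (X ⊕ Z) := ((Formula.iInf fun i : X => fF (Sum.inl i)) ⊓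
        Formula.iInf fun p : {p : X × X // p.1 ≠ p.2} =>
          ∼(Term.equal (Term.var (Sum.inl p.1.1)) (Term.var (Sum.inl p.1.2)))).imp
      (Formula.iExs Unit (fO (Sum.inr ()) ⊓ ((Formula.iInf fun i : Z =>
        ∼(fE (Sum.inr ()) (Sum.inl (Sum.inr i)))) ⊓
        ((Formula.iInf fun p : {p : X × X // s p.1 = s p.2} =>
          Term.equal (tEval (Sum.inl (Sum.inl p.1.1)) (Sum.inr ()))
            (tEval (Sum.inl (Sum.inl p.1.2)) (Sum.inr ()))) ⊓
        Formula.iInf fun p : {p : X × X // ¬ s p.1 = s p.2} =>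
          ∼(Term.equal (tEval (Sum.inl (Sum.inl p.1.1)) (Sum.inr ()))
            (tEval (Sum.inl (Sum.inl p.1.2)) (Sum.inr ())))))))
    have hθ : ∀ {P : Type} [L₁.Structure P] (v : X ⊕ Z → P), θ.Realize v ↔
        (((∀ i, F (v (Sum.inl i))) ∧ ∀ i j, i ≠ j → v (Sum.inl i) ≠ v (Sum.inl j)) →
          ∃ y, O y ∧ (∀ i, ¬ E y (v (Sum.inr i))) ∧
            ((∀ i j, s i = s j → eval (v (Sum.inl i)) y = eval (v (Sum.inl j)) y) ∧
            ∀ i j, ¬ s i = s j → ¬ eval (v (Sum.inl i)) y = eval (v (Sum.inl j)) y)) := by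
      intro P _ v
      simp only [θ, Formula.realize_imp, realize_fO, realize_fF, Formula.realize_iExs,
        Formula.realize_inf, realize_fE, Formula.realize_iInf, Formula.realize_not,
        Formula.realize_equal, Term.realize_var, Sum.elim_inl, Sum.elim_inr, realize_tEval,
        Subtype.forall, Prod.forall]
      exact imp_congr_right fun _ => ⟨fun ⟨y, hy⟩ => ⟨y (), hy⟩, fun ⟨y, hy⟩ => ⟨fun _ => y, hy⟩⟩
    obtain ⟨y, h1, h2, h3, h4⟩ := (hθ _).1 (realize_of_completeTheory (M := M) θ
      (fun v => (hθ v).2 fun hv => by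
        obtain ⟨y, h1, h2, h3⟩ := h.exists_class X Z s _ _ hv
        exact ⟨y, h1, h2, fun i j => (h3 i j).1, fun i j hij he => hij ((h3 i j).2 he)⟩)
      (Sum.elim x z)) hx
    exact ⟨y, h1, h2, fun i j => ⟨h3 i j, fun he => by_contra fun hij => h4 i j hij he⟩⟩

open Pt

theorem Pt.exists_obj_of_O {r : ℕ → ℕ → ℕ} {x : Pt r} (hx : O x) : ∃ κ n, x = obj κ n := by
  rcases x with ⟨κ, n⟩ | f
  · exact ⟨κ, n, rfl⟩
  · simp at hx

theorem Pt.exists_fn_of_F {r : ℕ → ℕ → ℕ} {x : Pt r} (hx : F x) : ∃ f, x = fn f := by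
  rcases x with ⟨κ, n⟩ | f
  · simp at hx
  · exact ⟨f, rfl⟩

theorem Generic.genericAxioms {r : ℕ → ℕ → ℕ} (hr : Generic r) : GenericAxioms (Pt r) where
  exists_obj Z _ z b hb := by
    rcases b with ⟨κ, n⟩ | f
    swap
    · simp at hb
    obtain ⟨n', hn'⟩ := (Set.finite_range fun i => num (z i)).exists_notMem
    refine ⟨obj κ n', by simp, fun i hi => hn' ⟨i, ?_⟩⟩
    simp [← hi, num]
  exists_fn X Z _ _ x z hx := by
    choose k n hk using fun i => exists_obj_of_O (hx.1 i)
    simp only [hk, E_obj_obj] at hx ⊢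
    obtain ⟨v, hv⟩ := Frame.exists_factor (p := k) (q := n) (by
      intro i j hij
      by_contra h
      exact hx.2 i j (fun h' => h (h' ▸ rfl)) hij)
    obtain ⟨f, hf, hfK⟩ := hr.exists_fn (Set.finite_range fun i => num (z i)).toFinset
      (Set.finite_range k).toFinset v
    simp only [Set.Finite.mem_toFinset, Set.mem_range, not_exists, forall_exists_index,
      forall_apply_eq_imp_iff] at hf hfK
    exact ⟨fn f, by simp, fun i hi => hf i (by simp [← hi, num]), fun i => by simp [hfK, hv]⟩
  exists_class X Z _ _ s x z hx := by
    choose k hk using fun i => exists_fn_of_F (hx.1 i)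
    simp only [hk, ne_eq, fn.injEq] at hx ⊢
    obtain ⟨v, hv⟩ := Frame.exists_factor (p := k) (q := s) (by
      intro i j hij
      by_contra h
      exact hx.2 i j (fun h' => h (h' ▸ rfl)) hij)
    obtain ⟨κ, hκ, g, hg⟩ := hr.exists_class (Set.finite_range k).toFinset
      (Set.finite_range fun i => cls (z i)).toFinset v
    simp only [Set.Finite.mem_toFinset, Set.mem_range, not_exists, forall_exists_index,
      forall_apply_eq_imp_iff] at hκ hg
    refine ⟨obj κ 0, by simp, fun i hi => hκ i ?_, fun i j => by simp [hg, hv]⟩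
    rcases hz : z i with ⟨κ', n⟩ | f
    · simpa [hz, cls, eq_comm] using hi
    · simp [hz] at hi

theorem GenericAxioms.generic {r : ℕ → ℕ → ℕ} (h : GenericAxioms (Pt r)) : Generic r where
  exists_fn Φ K v := by
    obtain ⟨y, h1, h2, h3⟩ := h.exists_fn K Φ (fun κ => obj κ.1 (v κ.1)) (fun f => fn f.1)
      ⟨by simp, fun i j hij h => hij (Subtype.ext (by simpa using h))⟩
    rcases y with _ | f
    · simp at h1
    · exact ⟨f, fun hf => h2 ⟨f, hf⟩ rfl, fun κ hκ => by simpa using h3 ⟨κ, hκ⟩⟩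
  exists_class Φ K v := by
    obtain ⟨y, h1, h2, h3⟩ := h.exists_class Φ K (fun f => v f.1) (fun f => fn f.1)
      (fun κ => obj κ.1 0) ⟨by simp, fun i j hij h => hij (Subtype.ext (by simpa using h))⟩
    rcases y with ⟨κ, n⟩ | f
    swap
    · simp at h1
    obtain ⟨g, hg⟩ := exists_perm (fun f : Φ => v f.1) (fun f : Φ => r f κ) (by simpa using h3)
    exact ⟨κ, fun hκ => by simpa using h2 ⟨κ, hκ⟩, g, fun f hf => (hg ⟨f, hf⟩).symm⟩

/-- The axioms make the set of functions, the set of classes and each class infinite. Enumerations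
by ℕ then serve as bijective coordinates, and the resulting embedding is onto. -/
theorem GenericAxioms.exists_equiv {N : Type} [L₁.Structure N] [Countable N] (hN : N ⊨ T₁)
    (h : GenericAxioms N) : ∃ r : ℕ → ℕ → ℕ, Nonempty (N ≃[L₁] Pt r) := by
  classical
  obtain ⟨h1, h2, h3, h4, h5, -⟩ := (model_T₁_iff N).1 hN
  have : Infinite {x : N // F x} := by
    by_contra hfin
    rw [not_infinite_iff_finite] at hfin
    obtain ⟨y, hy, hyz, -⟩ := h.exists_fn Empty {x : N // F x} Empty.elim Subtype.val
      ⟨fun i => i.elim, fun i => i.elim⟩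
    exact hyz ⟨y, hy⟩ rfl
  let s : Setoid {x : N // O x} := ⟨fun x y => E x.1 y.1, fun x => h3 _ x.2, fun h => h4 _ _ h,
    fun h h' => h5 _ _ _ h h'⟩
  have : Infinite (Quotient s) := by
    by_contra hfin
    rw [not_infinite_iff_finite] at hfin
    obtain ⟨y, hy, hyz, -⟩ := h.exists_class Empty (Quotient s) (fun _ => 0) Empty.elim
      (fun q => q.out.1) ⟨fun i => i.elim, fun i => i.elim⟩
    exact hyz (Quotient.mk s ⟨y, hy⟩) (Quotient.exact (Quotient.out_eq (Quotient.mk s ⟨y, hy⟩)).symm)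
  have : ∀ q : Quotient s, Infinite {x : {x : N // O x} // Quotient.mk s x = q} := by
    intro q
    by_contra hfin
    rw [not_infinite_iff_finite] at hfin
    obtain ⟨y, hy, hyz⟩ := h.exists_obj {x : {x : N // O x} // Quotient.mk s x = q}
      (fun x => x.1.1) q.out.1 q.out.2
    exact hyz ⟨⟨y, (h2 _ _ hy).1⟩, (Quotient.sound hy).trans q.out_eq⟩ rfl
  obtain ⟨eF⟩ := nonempty_equiv_of_countable (α := {x : N // F x}) (β := ℕ)
  obtain ⟨eQ⟩ := nonempty_equiv_of_countable (α := Quotient s) (β := ℕ)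
  have eC : ∀ q : Quotient s, {x : {x : N // O x} // Quotient.mk s x = q} ≃ ℕ := fun q =>
    (nonempty_equiv_of_countable (α := {x : {x : N // O x} // Quotient.mk s x = q}) (β := ℕ)).some
  have hFO : ∀ x : N, F x → ¬ O x := fun x hx h => (h1 x).1 h hx
  have hOF : ∀ x : N, ¬ O x → F x := fun x hx => by
    by_contra h
    exact hx ((h1 x).2 h)
  let cl : N → ℕ := fun x => if hx : O x then eQ (Quotient.mk s ⟨x, hx⟩) else 0
  let nu : N → ℕ := fun x => if hx : O x then eC (Quotient.mk s ⟨x, hx⟩) ⟨⟨x, hx⟩, rfl⟩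
    else eF ⟨x, hOF x hx⟩
  have hcl : ∀ x (hx : O x), cl x = eQ (Quotient.mk s ⟨x, hx⟩) := fun x hx => dif_pos hx
  have hnuO : ∀ x (hx : O x), nu x = eC (Quotient.mk s ⟨x, hx⟩) ⟨⟨x, hx⟩, rfl⟩ :=
    fun x hx => dif_pos hx
  have hnuC : ∀ x (hx : O x) q (hq : Quotient.mk s ⟨x, hx⟩ = q), nu x = eC q ⟨⟨x, hx⟩, hq⟩ := by
    rintro x hx q rfl
    exact hnuO x hx
  have hnuF : ∀ x (hx : F x), nu x = eF ⟨x, hx⟩ := fun x hx => dif_neg (hFO x hx)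
  obtain ⟨r, g, gO, gF⟩ := exists_embedding_of_coordinates hN cl nu
    (by
      intro x y hx hy
      rw [hcl x hx, hcl y hy, eQ.apply_eq_iff_eq, Quotient.eq]
      rfl)
    (by
      intro x y hxy he
      obtain ⟨hx, hy⟩ := h2 x y hxy
      rw [hnuC x hx _ (Quotient.sound (b := ⟨y, hy⟩) hxy), hnuO y hy, (eC _).apply_eq_iff_eq] at he
      exact congrArg (fun x => x.1.1) he)
    (by
      intro x y hx hy he
      rw [hnuF x hx, hnuF y hy, eF.apply_eq_iff_eq] at he
      exact congrArg Subtype.val he)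
  have hsurj : Function.Surjective g := by
    rintro (⟨κ, n⟩ | f)
    · obtain ⟨⟨⟨x, hx⟩, hq⟩, hxn⟩ := (eC (eQ.symm κ)).surjective n
      refine ⟨x, ?_⟩
      rw [gO x hx, hcl x hx, hnuC x hx _ hq, hxn, hq, Equiv.apply_symm_apply]
    · refine ⟨(eF.symm f).1, ?_⟩
      rw [gF _ (eF.symm f).2, hnuF _ (eF.symm f).2]
      simp
  exact ⟨r, ⟨⟨Equiv.ofBijective g ⟨g.injective, hsurj⟩, fun f x => g.map_fun f x,
    fun R x => g.map_rel R x⟩⟩⟩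

/-- A countable model of the theory of the Fraïssé limit is isomorphic to some generic `Pt r`. -/
theorem Generic.exists_equiv {q : ℕ → ℕ → ℕ} (hq : Generic q) {N : Type} [L₁.Structure N]
    [Countable N] [N ⊨ L₁.completeTheory (Pt q)] :
    ∃ r, Generic r ∧ Nonempty (N ≃[L₁] Pt r) := by
  have hT : N ⊨ T₁ := Theory.Model.mono (T' := L₁.completeTheory (Pt q)) inferInstance
    (Theory.model_iff_subset_completeTheory.1 (Pt.model_T₁ q))
  obtain ⟨r, ⟨g⟩⟩ := (hq.genericAxioms.of_completeTheory (N := N)).exists_equiv hT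
  have : Pt r ⊨ L₁.completeTheory (Pt q) := StrongHomClass.theory_model g
  exact ⟨r, (hq.genericAxioms.of_completeTheory (N := Pt r)).generic, ⟨g⟩⟩

theorem card_L₁_le : L₁.card ≤ Cardinal.aleph0 := by
  have : Countable (Σ l, L₁.Relations l) := by
    have : ∀ l, Countable (L₁.Relations l) := fun l => by
      refine Function.Injective.countable (β := ℕ) (f := fun R : Rel l => match R with
        | Rel.O => 0
        | Rel.F => 1
        | Rel.E => 2) ?_
      rintro (_ | _) R' h <;> cases R' <;> simp at h <;> rfl
    infer_instance
  rw [Language.card, Cardinal.mk_le_aleph0_iff]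
  exact inferInstanceAs (Countable (_ ⊕ _))

/-- Countably many elements of a model of the theory of the Fraïssé limit lie in an elementary
submodel isomorphic to some generic `Pt r`. -/
theorem Generic.exists_elementaryEmbedding {q : ℕ → ℕ → ℕ} (hq : Generic q) {N : Type}
    [L₁.Structure N] [N ⊨ L₁.completeTheory (Pt q)] {A : Type} [Countable A] (w : A → N) :
    ∃ r, Generic r ∧ ∃ (g : Pt r ↪ₑ[L₁] N) (w' : A → Pt r), ∀ a, g (w' a) = w a := by
  have hN : L₁.ElementarilyEquivalent (Pt q) N :=
    elementarilyEquivalent_iff.2 fun φ => (realize_iff_of_model_completeTheory (Pt q) N φ).symm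
  have : Infinite N := hN.infinite
  obtain ⟨S, hS, hcard⟩ := exists_elementarySubstructure_card_eq L₁ (Set.range w) Cardinal.aleph0
    le_rfl (Cardinal.lift_le.2 (Cardinal.mk_le_aleph0_iff.2 (Set.countable_range w).to_subtype)) (by simpa using card_L₁_le) (by simp)
  have : Countable S := by
    rw [← Cardinal.mk_le_aleph0_iff]
    simpa using hcard.le
  obtain ⟨r, hr, ⟨e⟩⟩ := hq.exists_equiv (N := S)
  refine ⟨r, hr, S.subtype.comp e.symm.toElementaryEmbedding,
    fun a => e ⟨w a, hS ⟨a, rfl⟩⟩, fun a => ?_⟩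
  simp

/-! ### Simplicity of the type of an object. -/

open Equiv Pt Selector.Frame TreeProperties

variable {r : ℕ → ℕ → ℕ}

/-- The indices of the functions in a set of points. -/
def fns (X : Set (Pt r)) : Set ℕ := {f | fn f ∈ X}

@[simp] theorem mem_fns {X : Set (Pt r)} {f : ℕ} : f ∈ fns X ↔ fn f ∈ X := Iff.rfl

/-- The indices of the classes that meet a set of points. -/
def classes (X : Set (Pt r)) : Set ℕ := {κ | ∃ n, obj κ n ∈ X}

theorem fns_finite {X : Set (Pt r)} (hX : X.Finite) : (fns X).Finite :=
  (hX.image num).subset fun _ hf => ⟨_, hf, rfl⟩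

theorem classes_finite {X : Set (Pt r)} (hX : X.Finite) : (classes X).Finite :=
  (hX.image cls).subset fun _ ⟨_, hκ⟩ => ⟨_, hκ, rfl⟩

theorem section_finite {X : Set (Pt r)} (hX : X.Finite) (κ : ℕ) : {n | obj κ n ∈ X}.Finite :=
  (hX.image num).subset fun _ hf => ⟨_, hf, rfl⟩

theorem Frame.Good.solutions_iff (hr : Generic r) {m n : ℕ} (φ : L₁.Formula (Fin m ⊕ Fin n))
    {A : Frame} {Φ K : Finset ℕ} (hA : Good r r A Φ K) {e : Fin m → Pt r} {a : Fin n → Pt r}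
    (he : ∀ i, Dom Φ K (e i)) (ha : ∀ i, Dom Φ K (a i)) :
    e ∈ solutions φ a ↔ (fun i => (A.map (e i) : Pt r)) ∈ solutions φ fun i => (A.map (a i) : Pt r) := by
  have := hA.formula_iff hr hr φ (v := Sum.elim e a) (by rintro (i | i); exacts [he i, ha i])
  rw [Sum.comp_elim] at this
  exact this

theorem exists_eventually_eq {α β : Type*} [Finite β] (U : Ultrafilter α) (c : α → β) :
    ∃ t, ∀ᶠ s in U, c s = t := by
  have := Fintype.ofFinite β
  have h : ∀ᶠ s in U, ∃ t ∈ (Set.univ : Set β), c s = t := .of_forall fun s => ⟨_, trivial, rfl⟩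
  obtain ⟨t, -, ht⟩ := (Ultrafilter.eventually_exists_mem_iff Set.finite_univ).1 h
  exact ⟨t, ht⟩

/-- Among infinitely many tuples there are infinitely many with the same quantifier-free type over
a finite closed set, pairwise disjoint outside that set, which can be chosen to contain a given
finite set. -/
theorem exists_disjoint_sequence {n : ℕ} {C : Set (Pt r)} (hC : C.Finite) (x : ℕ → Fin n → Pt r) :
    ∃ (D : Set (Pt r)) (f : ℕ → ℕ), C ⊆ D ∧ D.Finite ∧ (∀ a ∈ D, ∀ b ∈ D, eval a b ∈ D) ∧
      Function.Injective f ∧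
      (∀ i j, atomicType (Sum.elim (Subtype.val : D → Pt r) (x (f i))) =
        atomicType (Sum.elim (Subtype.val : D → Pt r) (x (f j)))) ∧
      ∀ i j, i ≠ j → ∀ l l', x (f i) l = x (f j) l' → x (f i) l ∈ D := by
  classical
  let U : Ultrafilter ℕ := Filter.hyperfilter ℕ
  -- Coordinates constant on a `U`-large set have their value put into `D`. Any other coordinate
  -- avoids each given point on a `U`-large set, so it can be kept off all earlier tuples.
  let J : Set (Fin n) := {l | ∃ d, ∀ᶠ s in U, x s l = d}
  choose d hd using fun l : J => l.2
  obtain ⟨D, hCD, hDfin, hDcl, hdD⟩ : ∃ D : Set (Pt r), C ⊆ D ∧ D.Finite ∧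
      (∀ a ∈ D, ∀ b ∈ D, eval a b ∈ D) ∧ ∀ l, d l ∈ D :=
    ⟨cl (C ∪ Set.range d), Set.subset_union_left.trans (subset_cl _),
      cl_finite (hC.union (Set.finite_range d)), fun a ha b hb => eval_mem_cl ha hb,
      fun l => subset_cl _ (Or.inr ⟨l, rfl⟩)⟩
  have : Finite D := hDfin
  obtain ⟨t, ht⟩ := exists_eventually_eq U
    fun s => atomicType (Sum.elim (Subtype.val : D → Pt r) (x s))
  have hd' : ∀ᶠ s in U, ∀ l : J, x s l = d l := Filter.eventually_all.2 hd
  have hne : ∀ T : Finset ℕ, ∀ᶠ s in U, ∀ q ∈ T, q ≠ s ∧ ∀ l ∉ J, ∀ l', x s l ≠ x q l' := by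
    intro T
    rw [Filter.eventually_all_finset]
    intro q _
    refine Filter.Eventually.and ?_ ?_
    · have : ({q}ᶜ : Set ℕ) ∈ U := Filter.compl_mem_hyperfilter_of_finite (Set.finite_singleton q)
      filter_upwards [this] with s hs
      exact fun h => hs h.symm
    · refine Filter.eventually_all.2 fun l => ?_
      by_cases hl : l ∈ J
      · exact .of_forall fun s h => absurd hl h
      have : ∀ᶠ s in U, ∀ l', x s l ≠ x q l' := by
        refine Filter.eventually_all.2 fun l' => Ultrafilter.eventually_not.2 fun h => hl ⟨_, h⟩
      filter_upwards [this] with s hs _ using hs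
  obtain ⟨f, hf, hff⟩ := exists_seq_of_forall_finset_exists
    (fun s => atomicType (Sum.elim (Subtype.val : D → Pt r) (x s)) = t ∧ ∀ l : J, x s l = d l)
    (fun q s => q ≠ s ∧ ∀ l ∉ J, ∀ l', x s l ≠ x q l')
    (fun T _ => ((ht.and hd').and (hne T)).exists)
  refine ⟨D, f, hCD, hDfin, hDcl, ?_, fun i j => (hf i).1.trans (hf j).1.symm, ?_⟩
  · intro i j hij
    rcases lt_trichotomy i j with h | h | h
    · exact absurd hij (hff i j h).1
    · exact h
    · exact absurd hij.symm (hff j i h).1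
  · intro i j hij l l' he
    have hJ : ∀ i, ∀ l ∈ J, x (f i) l ∈ D := fun i l hl => by
      rw [(hf i).2 ⟨l, hl⟩]
      exact hdD _
    rcases hij.lt_or_gt with h | h
    · by_cases hl : l' ∈ J
      · rw [he]
        exact hJ j l' hl
      · exact absurd he.symm ((hff i j h).2 l' hl l)
    · by_cases hl : l ∈ J
      · exact hJ i l hl
      · exact absurd he ((hff j i h).2 l hl l')

/-- If `φ(x; a i)` are `k`-inconsistent, then for some `i` each object satisfying `φ(x; a i)` is in
a finite set over which it was not before, or its class is. -/
theorem exists_new_of_kInconsistent (hr : Generic r) {n k : ℕ} (φ : L₁.Formula (Fin 1 ⊕ Fin n))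
    {C : Set (Pt r)} (hC : C.Finite) {x : ℕ → Fin n → Pt r}
    (hk : KInconsistent k fun i => solutions φ (x i)) :
    ∃ (s : ℕ) (C' : Set (Pt r)), C ⊆ C' ∧ C'.Finite ∧ ∀ κ m,
      (fun _ => obj κ m) ∈ solutions φ (x s) →
        (κ ∉ classes C ∧ κ ∈ classes C') ∨ (obj κ m ∉ C ∧ obj κ m ∈ C') := by
  classical
  obtain ⟨D, f, hCD, hD, hDcl, hf, htype, hdisj⟩ := exists_disjoint_sequence hC x
  let C' := cl (D ∪ Set.range (x (f 0)))
  have hC' : C'.Finite := cl_finite (hD.union (Set.finite_range _))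
  have hDC' : D ⊆ C' := Set.subset_union_left.trans (subset_cl _)
  have hxC' : ∀ l, x (f 0) l ∈ C' := fun l => subset_cl _ (Or.inr ⟨l, rfl⟩)
  refine ⟨f 0, C', hCD.trans hDC', hC', fun κ m hφ => ?_⟩
  by_contra hnew
  simp only [not_or, not_and'] at hnew
  obtain ⟨hκ, hm⟩ := hnew
  suffices ∃ b : Fin 1 → Pt r, ∀ i < k, b ∈ solutions φ (x (f i)) by
    obtain ⟨b, hb⟩ := this
    refine hk ((Finset.range k).map ⟨f, hf⟩) (by simp) ⟨b, ?_⟩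
    simpa using hb
  have : Finite D := hD
  choose A Φ K hA hdom hmap using fun i => exists_frame (htype 0 i)
  have hdomC' : ∀ i, ∀ y ∈ C', Dom (Φ i) (K i) y := by
    have h1 : ∀ i, ∀ y ∈ D ∪ Set.range (x (f 0)), Dom (Φ i) (K i) y := by
      rintro i y (hy | ⟨l, rfl⟩)
      · exact hdom i (Sum.inl ⟨y, hy⟩)
      · exact hdom i (Sum.inr l)
    rintro i (⟨κ, n⟩ | g) hy
    · obtain ⟨n', hn'⟩ := exists_obj_of_mem_cl hy
      exact (dom_obj _ _ _ _).1 (h1 i _ hn')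
    · exact h1 i _ (fn_mem_cl.1 hy)
  have hfix : ∀ i, ∀ y ∈ D, (A i).map y = y := fun i y hy => hmap i (Sum.inl ⟨y, hy⟩)
  have hmapx : ∀ i l, (A i).map (x (f 0) l) = x (f i) l := fun i l => hmap i (Sum.inr l)
  let Φ₀ := (fns_finite hC').toFinset
  let K₀ := (classes_finite hC').toFinset
  have hΦ₀ : ∀ i, Φ₀ ⊆ Φ i := fun i g hg => hdomC' i (fn g) (by simpa [Φ₀] using hg)
  have hK₀ : ∀ i, K₀ ⊆ K i := fun i κ hκ => by
    obtain ⟨n, hn⟩ : κ ∈ classes C' := by simpa [K₀] using hκ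
    exact hdomC' i _ hn
  have hA₀ : ∀ i, Good r r (A i) Φ₀ K₀ := fun i => (hA i).mono (hΦ₀ i) (hK₀ i)
  have hdom₀ : ∀ y ∈ C', Dom Φ₀ K₀ y := by
    rintro (⟨κ, n⟩ | g) hy
    · simpa [K₀] using ⟨n, hy⟩
    · simpa [Φ₀] using hy
  -- If the object is in `C'`, it is already in `C`. Every frame fixes it, so it satisfies all
  -- instances itself.
  by_cases hmC : obj κ m ∈ C'
  · refine ⟨fun _ => obj κ m, fun i _ => ?_⟩
    have := ((hA₀ i).solutions_iff hr φ (fun _ => hdom₀ _ hmC) (fun l => hdom₀ _ (hxC' l))).1 hφ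
    simpa only [hmapx, hfix i _ (hCD (not_not.1 (hm hmC)))] using this
  by_cases hκC : κ ∈ classes C'
  · obtain ⟨m₀, hm₀⟩ := not_not.1 (hκ hκC)
    have hτ : ∀ i, (A i).τ κ = κ := fun i => by
      have := hfix i _ (hCD hm₀)
      simp only [map_obj, obj.injEq] at this
      exact this.1
    -- The class is fixed but the object is not in `C'`. Each frame is corrected by a transposition
    -- to send it to one common `n'`, which avoids the images of `C'` so that no value is disturbed.
    obtain ⟨n', hn'⟩ := ((Set.finite_lt_nat k).biUnion fun i _ =>
      ((section_finite hC' κ).image ((A i).h κ))).exists_notMem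
    simp only [Set.mem_iUnion, Set.mem_image, Set.mem_ofPred_eq, not_exists, not_and] at hn'
    refine ⟨fun _ => obj κ n', fun i hi => ?_⟩
    let B : Frame := ⟨(A i).σ, (A i).τ,
      Function.update (A i).h κ (swap ((A i).h κ m) n' * (A i).h κ)⟩
    have hh : ∀ κ' n, obj κ' n ∈ C' → B.h κ' n = (A i).h κ' n := by
      intro κ' n hn
      by_cases he : κ' = κ
      · subst he
        simp only [B, Function.update_self, Perm.mul_apply]
        rw [swap_apply_of_ne_of_ne]
        · simp only [ne_eq, EmbeddingLike.apply_eq_iff_eq]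
          rintro rfl
          exact hmC hn
        · exact hn' i hi n hn
      · simp only [B, Function.update_of_ne he]
    have hB : Good r r B Φ₀ K₀ := by
      intro g hg κ' hκ'
      obtain ⟨n, hn⟩ : κ' ∈ classes C' := by simpa [K₀] using hκ'
      rw [hh κ' (r g κ') (value_mem_cl (n := n) (by simpa [Φ₀] using hg) hn)]
      exact hA₀ i g hg κ' hκ'
    have hBA : ∀ y ∈ C', (B.map y : Pt r) = (A i).map y := by
      rintro (⟨κ', n⟩ | g) hy
      · simp [hh κ' n hy, B]
      · simp [B]
    have := (hB.solutions_iff hr φ (e := fun _ => obj κ m) (fun _ => by simpa [K₀] using hκC)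
      (fun l => hdom₀ _ (hxC' l))).1 hφ
    simpa only [hBA _ (hxC' _), hmapx, map_obj, B, Function.update_self, Perm.mul_apply,
      swap_apply_left, hτ] using this
  -- The class is new, so it can be sent to one common class provided the frames do not clash on
  -- functions. Outside `D` the tuples are pairwise disjoint, and on `D` all frames are the
  -- identity.
  · have hcoh : ∀ i j, ∀ g ∈ Φ₀, ∀ g' ∈ Φ₀, (A i).σ g = (A j).σ g' → g = g' := by
      intro i j g hg g' hg' he
      by_cases hij : i = j
      · subst hij
        exact (A i).σ.injective he
      have hσ : ∀ i g, fn g ∈ D → (A i).σ g = g := fun i g hg => by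
        simpa using hfix i _ hg
      have hg : fn g ∈ C' := by simpa [Φ₀] using hg
      have hg' : fn g' ∈ C' := by simpa [Φ₀] using hg'
      by_cases hgD : fn g ∈ D
      · rw [hσ i g hgD, ← hσ j g hgD] at he
        exact (A j).σ.injective he
      by_cases hgD' : fn g' ∈ D
      · rw [hσ j g' hgD', ← hσ i g' hgD'] at he
        exact (A i).σ.injective he
      obtain ⟨l, hl⟩ := (fn_mem_cl.1 hg).resolve_left hgD
      obtain ⟨l', hl'⟩ := (fn_mem_cl.1 hg').resolve_left hgD'
      have h1 := hmapx i l
      have h2 := hmapx j l'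
      rw [hl, map_fn] at h1
      rw [hl', map_fn] at h2
      have h3 := hdisj i j hij l l' (by rw [← h1, ← h2, he])
      rw [← h1] at h3
      refine absurd ?_ hgD
      have h4 := hσ i _ h3
      rw [(A i).σ.injective h4] at h3
      exact h3
    obtain ⟨κ', -, g, B, hB⟩ := exists_extend_class hr (fun i : Fin (k + 1) => A i) (fun _ => Φ₀)
      (fun _ => K₀) (fun i => hA₀ i) κ (fun _ => by simpa [K₀] using hκC)
      (fun i j => hcoh i j) ∅
    refine ⟨fun _ => obj κ' (g m), fun i hi => ?_⟩
    obtain ⟨h1, h2, h3, h4, h5, h6⟩ := hB ⟨i, hi.trans (Nat.lt_succ_self k)⟩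
    have hBA : ∀ y ∈ C', ((B ⟨i, hi.trans (Nat.lt_succ_self k)⟩).map y : Pt r) = (A i).map y := by
      rintro (⟨κ', n⟩ | g) hy
      · have := hdom₀ _ hy
        simp [h4 κ' this, h5 κ' this]
      · simp [h1]
    have := (h6.solutions_iff hr φ (e := fun _ => obj κ m) (fun _ => by simp)
      (fun l => (hdom₀ _ (hxC' l)).mono subset_rfl (Finset.subset_insert _ _))).1 hφ
    simpa only [hBA _ (hxC' _), hmapx, map_obj, h2, h3] using this

/-- The formula `O(x)` is simple in `Pt r`. -/
theorem Generic.not_treeProperty (hr : Generic r) {n k : ℕ} (φ : L₁.Formula (Fin 1 ⊕ Fin n))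
    (a : List ℕ → Fin n → Pt r)
    (hk : ∀ η : List ℕ, KInconsistent k fun i : ℕ => solutions φ (a (η ++ [i]))) :
    ∃ η : List ℕ, ∀ b : Fin 1 → Pt r, O (b 0) → ∃ μ, μ <+: η ∧ b ∉ solutions φ (a μ) := by
  obtain ⟨s₁, C₁, h₁, hC₁, H₁⟩ := exists_new_of_kInconsistent hr φ Set.finite_empty (hk [])
  obtain ⟨s₂, C₂, h₂, hC₂, H₂⟩ := exists_new_of_kInconsistent hr φ hC₁ (hk [s₁])
  obtain ⟨s₃, C₃, h₃, hC₃, H₃⟩ := exists_new_of_kInconsistent hr φ hC₂ (hk [s₁, s₂])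
  -- Along the path, the class of `b` can be captured at most once and `b` itself at most once;
  -- three levels would need three such events.
  refine ⟨[s₁, s₂, s₃], fun b hb => ?_⟩
  by_contra! hcon
  obtain ⟨κ, m, hb⟩ := exists_obj_of_O hb
  obtain rfl : b = fun _ => obj κ m := by
    funext i
    rw [Subsingleton.elim i 0, hb]
  have H₁ := H₁ κ m (hcon _ (by simp))
  have H₂ := H₂ κ m (hcon _ (by simp))
  have H₃ := H₃ κ m (hcon _ (by simp))
  have hmono : ∀ {X Y : Set (Pt r)}, X ⊆ Y → κ ∈ classes X → κ ∈ classes Y :=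
    fun h ⟨n, hn⟩ => ⟨n, h hn⟩
  have e₂ := @h₂ (obj κ m)
  have e₃ := @h₃ (obj κ m)
  have d₂ := hmono h₂
  have d₃ := hmono h₃
  tauto

/-! ### NSOP₁ through amalgamation. -/

variable {r : ℕ → ℕ → ℕ}

theorem classes_mono {X Y : Set (Pt r)} (h : X ⊆ Y) : classes X ⊆ classes Y :=
  fun _ ⟨n, hn⟩ => ⟨n, h hn⟩

theorem relevant_mem_cl {X : Set (Pt r)} {κ n : ℕ} (hκ : κ ∈ classes X) (h : Relevant X κ n) :
    obj κ n ∈ cl X := by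
  rcases h with h | ⟨f, hf, rfl⟩
  · exact subset_cl X h
  · obtain ⟨m, hm⟩ := hκ
    exact value_mem_cl (subset_cl X hf) (subset_cl X hm)

/-- The independence theorem for `Pt r`: if `a` and `a'` have the same type over `C`, and `c`, `e`
are sufficiently independent over `C` from each other and from `a`, `a'`, then there is a tuple
which is related to `a'` as `e` to `a`, and to `c` as `e` to `c`. -/
theorem exists_amalgam (hr : Generic r) {m n : ℕ} {C D : Set (Pt r)} (hC : C.Finite)
    {a a' c : Fin n → Pt r} {e : Fin m → Pt r}
    (htype : atomicType (Sum.elim (Subtype.val : C → Pt r) a) =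
      atomicType (Sum.elim (Subtype.val : C → Pt r) a'))
    (hCD : C ⊆ D) (hD : ∀ x ∈ D, ∀ y ∈ D, eval x y ∈ D) (ha : Set.range a ⊆ D)
    (ha' : Set.range a' ⊆ D)
    (hnew : ∀ x ∈ cl (Set.range c ∪ Set.range e), x ∈ D → x ∈ C)
    (hnewc : ∀ κ ∈ classes (Set.range c ∪ Set.range e), κ ∈ classes D → κ ∈ classes C)
    (hce : ∀ f, fn f ∈ Set.range e → fn f ∈ Set.range c → fn f ∈ C)
    (hcec : ∀ κ ∈ classes (Set.range e), κ ∈ classes (Set.range c) → κ ∈ classes C) :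
    ∃ e' : Fin m → Pt r, ∀ φ : L₁.Formula (Fin m ⊕ Fin n),
      (e ∈ solutions φ a ↔ e' ∈ solutions φ a') ∧ (e ∈ solutions φ c ↔ e' ∈ solutions φ c) := by
  classical
  set X := Set.range c ∪ Set.range e
  have : Finite C := hC
  obtain ⟨A, Φ, K, hA, hdom, hmap⟩ := exists_frame htype
  have hfix : ∀ y ∈ C, A.map y = y := fun y hy => hmap (Sum.inl ⟨y, hy⟩)
  have hmapa : ∀ l, A.map (a l) = a' l := fun l => hmap (Sum.inr l)
  have hfixτ : ∀ κ ∈ classes C, A.τ κ = κ := fun κ ⟨n, hn⟩ => by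
    have := hfix _ hn
    rw [map_obj, obj.injEq] at this
    exact this.1
  have hfixσ : ∀ f, fn f ∈ C → A.σ f = f := fun f hf => by simpa using hfix _ hf
  have hfixh : ∀ κ n, obj κ n ∈ C → A.h κ n = n := fun κ n hn => by
    have := hfix _ hn
    rw [map_obj, obj.injEq] at this
    exact this.2
  let Y := C ∪ Set.range a
  have hY : Y.Finite := hC.union (Set.finite_range a)
  have hdomY : ∀ y ∈ Y, Dom Φ K y := by
    rintro y (hy | ⟨l, rfl⟩)
    exacts [hdom (Sum.inl ⟨y, hy⟩), hdom (Sum.inr l)]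
  have hmapY : ∀ y ∈ Y, A.map y ∈ D := by
    rintro y (hy | ⟨l, rfl⟩)
    · rw [hfix y hy]
      exact hCD hy
    · rw [hmapa]
      exact ha' ⟨l, rfl⟩
  have hYD : Y ⊆ D := Set.union_subset hCD ha
  have hclYD : cl Y ⊆ D := by
    rintro y (hy | ⟨u, hu, v, hv, rfl⟩)
    exacts [hYD hy, hD _ (hYD hu) _ (hYD hv)]
  have hmapclY : ∀ y ∈ cl Y, A.map y ∈ D := by
    rintro y (hy | ⟨u, hu, v, hv, rfl⟩)
    · exact hmapY y hy
    · rw [hA.map_eval (hdomY u hu) (hdomY v hv)]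
      exact hD _ (hmapY u hu) _ (hmapY v hv)
  -- Inside a class of `C`, the frame is corrected to follow `A` on `cl Y` and to fix `cl X`. The
  -- demands are compatible: by `hnew`, a point of `cl X` that lies in `cl Y` or in its image is in
  -- `C`, hence fixed by `A`.
  have hg : ∀ κ ∈ classes C, ∃ g : Perm ℕ, (∀ n, obj κ n ∈ cl Y → g n = A.h κ n) ∧
      ∀ n, obj κ n ∈ cl X → g n = n := by
    intro κ hκ
    have hcross : ∀ n n', obj κ n ∈ cl Y → obj κ n' ∈ cl X → (n = n' ↔ A.h κ n = n') := by
      intro n n' hn hn'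
      constructor
      · rintro rfl
        exact hfixh κ n (hnew _ hn' (hclYD hn))
      · intro h
        have h1 := hmapclY _ hn
        rw [map_obj, hfixτ κ hκ, h] at h1
        have h2 := hfixh κ n' (hnew _ hn' h1)
        exact (A.h κ).injective (h.trans h2.symm)
    have : Finite {n // obj κ n ∈ cl Y} := section_finite (cl_finite hY) κ
    have : Finite {n // obj κ n ∈ cl X} := section_finite (cl_finite
      ((Set.finite_range c).union (Set.finite_range e))) κ
    obtain ⟨g, hg⟩ := exists_perm (ι := {n // obj κ n ∈ cl Y} ⊕ {n // obj κ n ∈ cl X})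
      (Sum.elim (fun n => n.1) fun n => n.1) (Sum.elim (fun n => A.h κ n.1) fun n => n.1) (by
        rintro (⟨n, hn⟩ | ⟨n, hn⟩) (⟨n', hn'⟩ | ⟨n', hn'⟩)
        · simp
        · exact hcross n n' hn hn'
        · exact eq_comm.trans ((hcross n' n hn' hn).trans eq_comm)
        · simp)
    exact ⟨g, fun n hn => hg (Sum.inl ⟨n, hn⟩), fun n hn => hg (Sum.inr ⟨n, hn⟩)⟩
  choose! g hgY hgX using hg
  let B : Frame := ⟨A.σ, A.τ, fun κ => if κ ∈ classes C then g κ else A.h κ⟩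
  have hBh : ∀ κ n, obj κ n ∈ cl Y → B.h κ n = A.h κ n := by
    intro κ n hn
    by_cases hκ : κ ∈ classes C
    · simp only [B, if_pos hκ, hgY κ hκ n hn]
    · simp only [B, if_neg hκ]
  have hBX : ∀ κ n, κ ∈ classes C → obj κ n ∈ cl X → B.h κ n = n := by
    intro κ n hκ hn
    simp only [B, if_pos hκ, hgX κ hκ n hn]
  have hBmap : ∀ y ∈ Y, (B.map y : Pt r) = A.map y := by
    rintro (⟨κ, n⟩ | f) hy
    · simp [hBh κ n (subset_cl Y hy), B]
    · simp [B]
  let Z : Bool → Set (Pt r) := fun s => cond s (Set.range a) (Set.range c)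
  have hZ : ∀ s, (Z s).Finite := fun s => by cases s <;> exact Set.finite_range _
  -- The frame `true` carries `a` to `a'`, the frame `false` is the identity near `c`. Both domains
  -- also contain the functions and classes of `e` that come from `C`, where the two frames agree on
  -- `e`.
  let Φ' : Bool → Finset ℕ := fun s =>
    ((fns_finite (hZ s)).union ((fns_finite (Set.finite_range e)).inter_of_left (fns C))).toFinset
  let K' : Bool → Finset ℕ := fun s => ((classes_finite (hZ s)).union
    ((classes_finite (Set.finite_range e)).inter_of_left (classes C))).toFinset
  have hΦ' : ∀ s f, f ∈ Φ' s ↔ f ∈ fns (Z s) ∨ f ∈ fns (Set.range e) ∧ f ∈ fns C := fun s f => by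
    simp only [Φ', Set.Finite.mem_toFinset, Set.mem_union, Set.mem_inter_iff]
  have hK' : ∀ s κ, κ ∈ K' s ↔ κ ∈ classes (Z s) ∨ κ ∈ classes (Set.range e) ∧ κ ∈ classes C :=
    fun s κ => by simp only [K', Set.Finite.mem_toFinset, Set.mem_union, Set.mem_inter_iff]
  have hΦt : ∀ f ∈ Φ' true, fn f ∈ Y := fun f hf =>
    ((hΦ' _ _).1 hf).elim (fun h => Or.inr h) (fun h => Or.inl h.2)
  have hΦf : ∀ f ∈ Φ' false, fn f ∈ X := fun f hf =>
    ((hΦ' _ _).1 hf).elim (fun h => Or.inl h) (fun h => Or.inr h.1)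
  have hKt : ∀ κ ∈ K' true, κ ∈ classes Y := fun κ hκ =>
    ((hK' _ _).1 hκ).elim (fun h => classes_mono Set.subset_union_right h)
      (fun h => classes_mono Set.subset_union_left h.2)
  have hKf : ∀ κ ∈ K' false, κ ∈ classes X := fun κ hκ =>
    ((hK' _ _).1 hκ).elim (fun h => classes_mono Set.subset_union_left h)
      (fun h => classes_mono Set.subset_union_right h.1)
  have hσ : ∀ f ∈ Φ' true, ∀ f' ∈ Φ' false, B.σ f = f' → f = f' := by
    intro f hf f' hf' h
    have h1 := hmapY _ (hΦt f hf)
    rw [map_fn, show A.σ f = f' from h] at h1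
    have h2 := hfixσ f' (hnew _ (subset_cl X (hΦf f' hf')) h1)
    exact A.σ.injective ((show A.σ f = f' from h).trans h2.symm)
  have hτC : ∀ κ ∈ K' true, ∀ κ' ∈ K' false, B.τ κ = κ' → κ' ∈ classes C := by
    intro κ hκ κ' hκ' h
    obtain ⟨n, hn⟩ := hKt κ hκ
    have h1 := hmapY _ hn
    rw [map_obj, show A.τ κ = κ' from h] at h1
    exact hnewc κ' (hKf κ' hκ') ⟨_, h1⟩
  have hτ : ∀ κ ∈ K' true, ∀ κ' ∈ K' false, B.τ κ = κ' → κ = κ' := by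
    intro κ hκ κ' hκ' h
    have h2 := hfixτ κ' (hτC κ hκ κ' hκ' h)
    exact A.τ.injective ((show A.τ κ = κ' from h).trans h2.symm)
  have hrel : ∀ κ ∈ K' true, κ ∈ K' false → B.τ κ = κ → ∀ n, Relevant X κ n → B.h κ n = n := by
    intro κ hκ hκ' h n hn
    exact hBX κ n (hτC κ hκ κ hκ' h) (relevant_mem_cl (hKf κ hκ') hn)
  have hcoh : Coherent r X (fun s : Bool => cond s B refl) Φ' K' := by
    refine ⟨?_, ?_, ?_, ?_⟩
    · rintro (_ | _)
      · exact fun f _ κ _ => rfl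
      · intro f hf κ hκ
        have h1 := hdomY _ (hΦt f hf)
        obtain ⟨n, hn⟩ := hKt κ hκ
        have h2 := hdomY _ hn
        simp only [cond_true]
        rw [hBh κ _ (value_mem_cl (n := n) (subset_cl Y (hΦt f hf)) (subset_cl Y hn))]
        exact hA f h1 κ h2
    · rintro (_ | _) (_ | _) f hf f' hf' h
      · exact h
      · exact (hσ f' hf' f hf h.symm).symm
      · exact hσ f hf f' hf' h
      · exact B.σ.injective h
    · rintro (_ | _) (_ | _) f hf f' hf' h
      · exact h
      · exact (hτ f' hf' f hf h.symm).symm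
      · exact hτ f hf f' hf' h
      · exact B.τ.injective h
    · rintro (_ | _) (_ | _) κ hκ hκ' h n hn
      · rfl
      · exact (hrel κ hκ' hκ h.symm n hn).symm
      · exact hrel κ hκ hκ' h n hn
      · rfl
  -- By the independence hypotheses, each entry of `e` is either already settled through `C` or
  -- outside both domains. Its common image is the entry of the required tuple.
  obtain ⟨F, Φ'', K'', hF, hFB, hset⟩ := hcoh.exists_settle_all hr
    ((Set.finite_range c).union (Set.finite_range e)) (Set.range e) Set.subset_union_right (by
      rintro (⟨κ, n⟩ | f) hx
      · have hκe : κ ∈ classes (Set.range e) := ⟨n, hx⟩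
        by_cases hκ : κ ∈ classes C
        · refine Or.inl ⟨fun s => (hK' s κ).2 (Or.inr ⟨hκe, hκ⟩), ?_⟩
          have h1 : (B.map (obj κ n : Pt r) : Pt r) = obj κ n := by
            rw [map_obj, hBX κ n hκ (subset_cl X (Or.inr hx))]
            exact congrArg (obj · n) (hfixτ κ hκ)
          rintro (_ | _) (_ | _) <;> simp only [cond_true, cond_false, refl_map, h1]
        · refine Or.inr fun s hs => ?_
          rcases (hK' s κ).1 hs with h | h
          · cases s
            · exact hκ (hcec κ hκe h)
            · exact hκ (hnewc κ (classes_mono Set.subset_union_right hκe) (classes_mono ha h))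
          · exact hκ h.2
      · by_cases hf : fn f ∈ C
        · refine Or.inl ⟨fun s => (hΦ' s f).2 (Or.inr ⟨hx, hf⟩), ?_⟩
          have h1 : (B.map (fn f : Pt r) : Pt r) = fn f := congrArg fn (hfixσ f hf)
          rintro (_ | _) (_ | _) <;> simp only [cond_true, cond_false, refl_map, h1]
        · refine Or.inr fun s hs => ?_
          rcases (hΦ' s f).1 hs with h | h
          · cases s
            · exact hf (hce f hx h)
            · exact hf (hnew _ (subset_cl X (Or.inr hx)) (ha h))
          · exact hf h.2)
  have hdomZ : ∀ s, ∀ z ∈ Z s, Dom (Φ' s) (K' s) z := by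
    rintro s (⟨κ, n⟩ | f) hz
    · exact (hK' s κ).2 (Or.inl ⟨n, hz⟩)
    · exact (hΦ' s f).2 (Or.inl hz)
  refine ⟨fun i => (F true).map (e i), fun φ => ⟨?_, ?_⟩⟩
  · rw [(hF.good true).solutions_iff hr φ (fun i => (hset _ ⟨i, rfl⟩).1 true)
      (fun l => (hFB true _ (hdomZ true (a l) ⟨l, rfl⟩)).1)]
    have : (fun l => ((F true).map (a l) : Pt r)) = a' := by
      funext l
      rw [(hFB true _ (hdomZ true (a l) ⟨l, rfl⟩)).2, ← hmapa l]
      exact hBmap _ (Or.inr ⟨l, rfl⟩)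
    rw [this]
  · rw [(hF.good false).solutions_iff hr φ (fun i => (hset _ ⟨i, rfl⟩).1 false)
      (fun l => (hFB false _ (hdomZ false (c l) ⟨l, rfl⟩)).1)]
    have h1 : (fun l => ((F false).map (c l) : Pt r)) = c := by
      funext l
      rw [(hFB false _ (hdomZ false (c l) ⟨l, rfl⟩)).2]
      exact refl_map _
    have h2 : (fun i => ((F false).map (e i) : Pt r)) = fun i => (F true).map (e i) := by
      funext i
      exact (hset _ ⟨i, rfl⟩).2 false true
    rw [h1, h2]

/-- The number of elements of the closure of `Z` in `C`, plus the number of classes of `Z` that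
meet `C`. -/
noncomputable def rank (Z C : Set (Pt r)) : ℕ :=
  (cl Z ∩ C).ncard + (classes Z ∩ classes C).ncard

theorem rank_mono {Z C D : Set (Pt r)} (hZ : Z.Finite) (h : C ⊆ D) : rank Z C ≤ rank Z D :=
  add_le_add (Set.ncard_le_ncard (Set.inter_subset_inter_right _ h) ((cl_finite hZ).inter_of_left _))
    (Set.ncard_le_ncard (Set.inter_subset_inter_right _ (classes_mono h))
      ((classes_finite hZ).inter_of_left _))

theorem rank_le {Z C : Set (Pt r)} (hZ : Z.Finite) {k : ℕ} (hk : Z.ncard ≤ k) :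
    rank Z C ≤ k + k * k + k := by
  have h1 : (cl Z).ncard ≤ k + k * k := by
    refine (Set.ncard_union_le _ _).trans (add_le_add hk ?_)
    rw [← Set.image_prod]
    refine (Set.ncard_image_le (hZ.prod hZ)).trans ?_
    rw [Set.ncard_prod]
    exact Nat.mul_le_mul hk hk
  have h2 : (classes Z).ncard ≤ k :=
    (Set.ncard_le_ncard (show classes Z ⊆ cls '' Z from fun κ ⟨n, hn⟩ => ⟨_, hn, rfl⟩)
      (hZ.image _)).trans
      ((Set.ncard_image_le hZ).trans hk)
  exact add_le_add ((Set.ncard_le_ncard Set.inter_subset_left (cl_finite hZ)).trans h1)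
    ((Set.ncard_le_ncard Set.inter_subset_left (classes_finite hZ)).trans h2)

/-- Both summands of `rank` are monotone, so equality of the sums forces equality of each finite
intersection. -/
theorem mem_of_rank_eq {Z C D : Set (Pt r)} (hZ : Z.Finite) (h : C ⊆ D)
    (hr : rank Z C = rank Z D) :
    (∀ x ∈ cl Z, x ∈ D → x ∈ C) ∧ ∀ κ ∈ classes Z, κ ∈ classes D → κ ∈ classes C := by
  have h1 := Set.ncard_le_ncard (Set.inter_subset_inter_right (cl Z) h)
    ((cl_finite hZ).inter_of_left _)
  have h2 := Set.ncard_le_ncard (Set.inter_subset_inter_right (classes Z) (classes_mono h))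
    ((classes_finite hZ).inter_of_left _)
  rw [rank, rank] at hr
  have h3 := Set.eq_of_subset_of_ncard_le (Set.inter_subset_inter_right (cl Z) h) (by omega)
    ((cl_finite hZ).inter_of_left _)
  have h4 := Set.eq_of_subset_of_ncard_le
    (Set.inter_subset_inter_right (classes Z) (classes_mono h)) (by omega)
    ((classes_finite hZ).inter_of_left _)
  exact ⟨fun x hx hxD => (h3.ge ⟨hx, hxD⟩).2, fun κ hκ hκD => (h4.ge ⟨hκ, hκD⟩).2⟩

theorem exists_eq_succ_of_bounded {f : ℕ → ℕ} {b : ℕ} (hf : ∀ s, f s ≤ f (s + 1))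
    (hb : ∀ s, f s ≤ b) : ∃ s ≤ b, f s = f (s + 1) := by
  by_contra! h
  have : ∀ s ≤ b + 1, s ≤ f s := by
    intro s
    induction s with
    | zero => simp
    | succ s ih =>
      intro hs
      have h1 := ih (by omega)
      have h2 := h s (by omega)
      have h3 := hf s
      omega
  have h1 := this (b + 1) le_rfl
  have h2 := hb (b + 1)
  omega

theorem ncard_range_le {m : ℕ} (e : Fin m → Pt r) : (Set.range e).ncard ≤ m := by
  rw [← Set.image_univ]
  refine (Set.ncard_image_le Set.finite_univ).trans ?_
  simp [Set.ncard_univ]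

/-- The step in the construction of the sequence of pairs in `Generic.not_SOP1`. -/
theorem exists_branching {n : ℕ} (a : List Bool → Fin n → Pt r) {C : Set (Pt r)} (hC : C.Finite)
    (ρ : List Bool) : ∃ η ν : List Bool, ρ <+: η ∧ η ++ [false] <+: ν ∧
      atomicType (Sum.elim (Subtype.val : C → Pt r) (a ν)) =
        atomicType (Sum.elim (Subtype.val : C → Pt r) (a (η ++ [true]))) := by
  have : Finite C := hC
  -- Over a finite set there are finitely many quantifier-free types, so two teeth `ρ⌢0ʲ⌢1` of a
  -- comb agree. The longer one passes through `η⌢0` for the shorter one `η⌢1`.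
  obtain ⟨j, j', hne, he⟩ := Finite.exists_ne_map_eq_of_infinite fun j : ℕ =>
    atomicType (Sum.elim (Subtype.val : C → Pt r) (a (ρ ++ List.replicate j false ++ [true])))
  wlog h : j < j' generalizing j j'
  · exact this j' j hne.symm he.symm (by omega)
  refine ⟨ρ ++ List.replicate j false, ρ ++ List.replicate j' false ++ [true],
    List.prefix_append _ _, ?_, he.symm⟩
  obtain ⟨d, rfl⟩ : ∃ d, j' = j + 1 + d := ⟨j' - (j + 1), by omega⟩
  refine ⟨List.replicate d false ++ [true], ?_⟩
  simp [List.replicate_add]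

/-- `Pt r` has no tree witnessing SOP₁. -/
theorem Generic.not_SOP1 (hr : Generic r) {m n : ℕ} (φ : L₁.Formula (Fin m ⊕ Fin n))
    (a : List Bool → Fin n → Pt r)
    (hcons : ∀ ν, ∃ x, ∀ μ, μ <+: ν → x ∈ solutions φ (a μ))
    (hinc : ∀ η ν : List Bool, (η ++ [false]) <+: ν →
      ¬ (solutions φ (a ν) ∩ solutions φ (a (η ++ [true]))).Nonempty) : False := by
  choose η ν hη hν htype using fun p : {C : Set (Pt r) // C.Finite} × List Bool =>
    exists_branching a p.1.2 p.2
  let step : {C : Set (Pt r) // C.Finite} × List Bool → {C : Set (Pt r) // C.Finite} × List Bool :=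
    fun p => (⟨cl (p.1.1 ∪ (Set.range (a (ν p)) ∪ Set.range (a (η p ++ [true])))),
      cl_finite (p.1.2.union ((Set.finite_range _).union (Set.finite_range _)))⟩, ν p)
  let st : ℕ → {C : Set (Pt r) // C.Finite} × List Bool :=
    fun i => step^[i] (⟨∅, Set.finite_empty⟩, [])
  have hst : ∀ i, st (i + 1) = step (st i) := fun i => Function.iterate_succ_apply' _ _ _
  let C : ℕ → Set (Pt r) := fun i => (st i).1.1
  let ρ : ℕ → List Bool := fun i => (st i).2
  have hCs : ∀ i, C (i + 1) =
      cl (C i ∪ (Set.range (a (ρ (i + 1))) ∪ Set.range (a (η (st i) ++ [true])))) := fun i => by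
    simp only [C, ρ, hst, step]
  have hρs : ∀ i, ρ (i + 1) = ν (st i) := fun i => by simp only [ρ, hst, step]
  have hCmono : Monotone C := monotone_nat_of_le_succ fun i => by
    rw [hCs]
    exact Set.subset_union_left.trans (subset_cl _)
  have hρ1 : ∀ i, η (st i) ++ [false] <+: ρ (i + 1) := fun i => by
    rw [hρs]
    exact hν _
  have hρ : ∀ i j, i ≤ j → ρ i <+: ρ j := by
    intro i j hij
    induction j, hij using Nat.le_induction with
    | base => exact List.prefix_rfl
    | succ j _ ih => exact ih.trans (((hη (st j)).trans (List.prefix_append _ _)).trans (hρ1 j))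
  -- This is the bound of `rank_le` for at most `n + m` points. The chain is cut into `b + 1` blocks
  -- of `w = b + 1` steps.
  let b := (n + m) + (n + m) * (n + m) + (n + m)
  let w := b + 1
  obtain ⟨e, he⟩ := hcons (ρ (w * (b + 1)))
  have hcard : ∀ c : Fin n → Pt r, (Set.range c ∪ Set.range e).ncard ≤ n + m := fun c =>
    (Set.ncard_union_le _ _).trans (add_le_add (ncard_range_le _) (ncard_range_le _))
  have hefin := Set.finite_range e
  -- First pigeonhole: in some block, `e` meets nothing new. With `c` taken at the end of the block,
  -- whatever `c` and `e` share already comes from the start of the block.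
  obtain ⟨s, hs, hse⟩ := exists_eq_succ_of_bounded (f := fun s => rank (Set.range e) (C (w * s)))
    (b := b) (fun s => rank_mono hefin (hCmono (Nat.mul_le_mul_left _ (Nat.le_succ s))))
    (fun s => rank_le hefin ((ncard_range_le e).trans (Nat.le_add_left _ _)))
  obtain ⟨hw, hwc⟩ := mem_of_rank_eq hefin
    (hCmono (Nat.mul_le_mul_left w (Nat.le_succ s))) hse
  obtain ⟨j, hj⟩ : ∃ j, j + 1 = w * (s + 1) := ⟨w * s + b, by simp only [w]; ring⟩
  have hjs : j = w * s + b := by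
    have : w * (s + 1) = w * s + (b + 1) := by simp only [w]; ring
    omega
  let c := a (ρ (j + 1))
  have hXfin : (Set.range c ∪ Set.range e).Finite := (Set.finite_range c).union hefin
  -- Second pigeonhole: at some step within the block, `c` and `e` together meet nothing new.
  obtain ⟨u, hu, hue⟩ := exists_eq_succ_of_bounded
    (f := fun u => rank (Set.range c ∪ Set.range e) (C (w * s + u))) (b := b)
    (fun u => rank_mono hXfin (hCmono (Nat.le_succ _))) (fun u => rank_le hXfin (hcard c))
  obtain ⟨hα, hαc⟩ := mem_of_rank_eq hXfin (hCmono (Nat.le_succ (w * s + u))) hue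
  let i := w * s + u
  have hij : i ≤ j := by simp only [i]; omega
  have hsub : C i ∪ (Set.range (a (ρ (i + 1))) ∪ Set.range (a (η (st i) ++ [true]))) ⊆ C (i + 1) := by
    rw [hCs]
    exact subset_cl _
  have hcC : Set.range c ⊆ C (w * (s + 1)) := by
    rw [← hj, hCs]
    exact (Set.subset_union_left.trans Set.subset_union_right).trans (subset_cl _)
  have hCi : C (w * s) ⊆ C i := hCmono (Nat.le_add_right _ _)
  obtain ⟨e', he'⟩ := exists_amalgam hr (C := C i) (D := C (i + 1)) (a := a (ρ (i + 1)))
    (a' := a (η (st i) ++ [true])) (c := c) (e := e) (st i).1.2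
    (by rw [hρs]; exact htype (st i))
    (hCmono (Nat.le_succ i)) (by rw [hCs]; exact fun x hx y hy => eval_mem_cl hx hy)
    ((Set.subset_union_left.trans Set.subset_union_right).trans hsub)
    ((Set.subset_union_right.trans Set.subset_union_right).trans hsub) hα hαc
    (fun f hf hfc => hCi (hw _ (subset_cl _ hf) (hcC hfc)))
    (fun κ hκ hκc => classes_mono hCi (hwc κ hκ (classes_mono hcC hκc)))
  have hM : j + 1 ≤ w * (b + 1) := by
    rw [hj]
    exact Nat.mul_le_mul_left _ (by omega)
  have h1 := (he' φ).1.1 (he _ (hρ (i + 1) _ (by omega)))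
  have h2 := (he' φ).2.1 (he _ (hρ (j + 1) _ hM))
  -- The node of `c` extends `η⌢0`, while the amalgam also satisfies the instance at `η⌢1`.
  exact hinc (η (st i)) (ρ (j + 1)) ((hρ1 i).trans (hρ _ _ (by omega))) ⟨e', h2, h1⟩

end Selector

/-! ### Transfer to arbitrary models, and the four conclusions. -/

namespace TreeProperties

theorem restrict_getD {A : Type} (d : A) {μ ν : List A} (h : μ <+: ν) :
    restrict (fun i => ν.getD i d) μ.length = μ := by
  obtain ⟨t, rfl⟩ := h
  refine List.ext_getElem (by simp [restrict]) fun i h1 h2 => ?_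
  simp [restrict, List.getElem?_append_left h2, h2]

/-- A consistent branch through `ν` is satisfied along `ν`. -/
theorem exists_mem_of_prefix {A X : Type} (d : A) {D : List A → Set X}
    (h : ∀ η : ℕ → A, Consistent fun i : ℕ => D (restrict η i)) (ν : List A) :
    ∃ x, ∀ μ, μ <+: ν → x ∈ D μ := by
  -- The tail `d` of the branch is irrelevant; the bound `ν.length + 1` includes the node `ν`
  -- itself.
  obtain ⟨x, hx⟩ := h (fun i => ν.getD i d) (Finset.range (ν.length + 1))
  refine ⟨x, fun μ hμ => ?_⟩
  have := Set.mem_iInter₂.1 hx μ.length (Finset.mem_range.2 (Nat.lt_succ_of_le hμ.length_le))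
  beta_reduce at this
  rwa [restrict_getD d hμ] at this

theorem mem_solutions_map_iff {L : FirstOrder.Language} {M N : Type*} [L.Structure M]
    [L.Structure N] (g : M ↪ₑ[L] N) {α β : Type} (φ : L.Formula (α ⊕ β)) (x : α → M) (b : β → M) :
    (fun i => g (x i)) ∈ solutions φ (fun i => g (b i)) ↔ x ∈ solutions φ b := by
  have := g.map_formula φ (Sum.elim x b)
  rw [Sum.comp_elim] at this
  exact this

end TreeProperties

namespace Selector

open Pt TreeProperties

variable {q : ℕ → ℕ → ℕ}

/-- The tree and one realization of each finite path form a countable set, so an elementary generic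
`Pt r` contains them all. -/
theorem Generic.nsop1 (hq : Generic q) : NSOP1 (L₁.completeTheory (Pt q)) := by
  rintro m n φ ⟨N, a, hcons, hinc⟩
  choose x hx using exists_mem_of_prefix (D := fun ν => solutions φ (a ν)) false hcons
  obtain ⟨r, hr, g, w, hw⟩ := hq.exists_elementaryEmbedding (N := N)
    (A := (List Bool × Fin n) ⊕ (List Bool × Fin m))
    (Sum.elim (fun p => a p.1 p.2) fun p => x p.1 p.2)
  have ha : ∀ ν, (fun i => g (w (Sum.inl (ν, i)))) = a ν := fun ν => by simp [hw]
  have hx' : ∀ ν, (fun i => g (w (Sum.inr (ν, i)))) = x ν := fun ν => by simp [hw]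
  refine hr.not_SOP1 φ (fun ν i => w (Sum.inl (ν, i)))
    (fun ν => ⟨fun i => w (Sum.inr (ν, i)), fun μ hμ => ?_⟩) fun η ν hν => ?_
  · rw [← mem_solutions_map_iff g, ha, hx']
    exact hx ν μ hμ
  · rintro ⟨y, h1, h2⟩
    rw [← mem_solutions_map_iff g, ha] at h1 h2
    exact hinc η ν hν ⟨_, h1, h2⟩

/-- The type of an object. -/
noncomputable def objectType (q : ℕ → ℕ → ℕ) : (L₁.completeTheory (Pt q)).CompleteType (Fin 1) :=
  (L₁.completeTheory (Pt q)).typeOf (fun _ => (obj 0 0 : Pt q))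

theorem mem_formulasOf_objectType {ψ : L₁.Formula (Fin 1)} :
    ψ ∈ formulasOf (objectType q) ↔ ψ.Realize fun _ => (obj 0 0 : Pt q) :=
  Theory.CompleteType.formula_mem_typeOf (T := L₁.completeTheory (Pt q))

theorem realize_formulaO {M : Type*} [L₁.Structure M] (v : Fin 1 → M) :
    formulaO.Realize v ↔ O (v 0) :=
  realize_fO 0 v

/-- Transpositions move one object to any other. With no functions in its domain such a frame is
vacuously good, so it preserves formulas. -/
theorem Generic.realize_of_mem_objectType (hq : Generic q) {ψ : L₁.Formula (Fin 1)}
    (hψ : ψ ∈ formulasOf (objectType q)) {v : Fin 1 → Pt q} (hv : O (v 0)) : ψ.Realize v := by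
  obtain ⟨κ, n, h⟩ := exists_obj_of_O hv
  obtain rfl : v = fun _ => obj κ n := by
    funext i
    rw [Subsingleton.elim i 0, h]
  have hA : Frame.Good q q ⟨1, Equiv.swap 0 κ, fun _ => Equiv.swap 0 n⟩ ∅ {0} := by
    simp [Frame.Good]
  have := (hA.formula_iff hq hq ψ (v := fun _ => obj 0 0) (by simp)).1
    (mem_formulasOf_objectType.1 hψ)
  simpa [Function.comp_def] using this

theorem Generic.axiomatizes (hq : Generic q) :
    Axiomatizes (L₁.completeTheory (Pt q)) formulaO (objectType q) := by
  refine ⟨mem_formulasOf_objectType.2 ((realize_formulaO _).2 (by simp)), fun ψ hψ => ?_⟩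
  rw [Theory.models_formula_iff]
  intro N v
  exact realize_of_completeTheory (M := Pt q) (formulaO.imp ψ) (fun v => Formula.realize_imp.2
    fun h => hq.realize_of_mem_objectType hψ ((realize_formulaO v).1 h)) v

theorem Generic.isSimpleType (hq : Generic q) :
    IsSimpleType (L₁.completeTheory (Pt q)) (formulasOf (objectType q)) := by
  rintro ⟨n, φ, k, N, a, hk, hcons⟩
  obtain ⟨x, hx⟩ : ∃ x : List ℕ → Fin 1 → N, ∀ ν, O (x ν 0) ∧ ∀ μ, μ <+: ν →
      x ν ∈ solutions φ (a μ) := by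
    have := exists_mem_of_prefix (D := fun ν => {x : Fin 1 → N | O (x 0)} ∩ solutions φ (a ν)) 0
      (fun η s => by
        classical
        -- Of the whole type only `formulaO` is needed, adjoined to each finite set of instances.
        obtain ⟨x, hx⟩ := hcons η (insert (Sum.inl ⟨formulaO, hq.axiomatizes.1⟩)
          (s.map ⟨Sum.inr, Sum.inr_injective⟩))
        simp only [Finset.mem_insert, Finset.mem_map, Function.Embedding.coeFn_mk,
          Set.iInter_iInter_eq_or_left, Set.mem_inter_iff, Set.mem_iInter, Sum.elim_inl] at hx
        refine ⟨x, Set.mem_iInter₂.2 fun i hi => ⟨(realize_formulaO x).1 hx.1, ?_⟩⟩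
        exact hx.2 (Sum.inr i) ⟨i, hi, rfl⟩)
    choose x hx using this
    exact ⟨x, fun ν => ⟨(hx ν ν List.prefix_rfl).1, fun μ hμ => (hx ν μ hμ).2⟩⟩
  obtain ⟨r, hr, g, w, hw⟩ := hq.exists_elementaryEmbedding (N := N)
    (A := (List ℕ × Fin n) ⊕ (List ℕ × Fin 1))
    (Sum.elim (fun p => a p.1 p.2) fun p => x p.1 p.2)
  have ha : ∀ ν, (fun i => g (w (Sum.inl (ν, i)))) = a ν := fun ν => by simp [hw]
  have hx' : ∀ ν, (fun i => g (w (Sum.inr (ν, i)))) = x ν := fun ν => by simp [hw]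
  obtain ⟨η, hη⟩ := hr.not_treeProperty φ (fun ν i => w (Sum.inl (ν, i))) (k := k) (by
    rintro η s hs ⟨y, hy⟩
    refine hk η s hs ⟨fun i => g (y i), Set.mem_iInter₂.2 fun i hi => ?_⟩
    have := Set.mem_iInter₂.1 hy i hi
    rwa [← mem_solutions_map_iff g, ha] at this)
  obtain ⟨μ, hμ, hn⟩ := hη (fun i => w (Sum.inr (η, i))) (by
    rw [← O_map_embedding g.toEmbedding]
    have := (hx η).1
    rw [← hx'] at this
    exact this)
  rw [← mem_solutions_map_iff g, ha, hx'] at hn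
  exact hn ((hx η).2 μ hμ)

/-- The formula `F(x) ∧ eval(x, y) = y`. -/
noncomputable def selects : L₁.Formula (Fin 1 ⊕ Fin 1) :=
  fF (Sum.inl 0) ⊓ Term.equal (tEval (Sum.inl 0) (Sum.inr 0)) (Term.var (Sum.inr 0))

theorem mem_solutions_selects {M : Type*} [L₁.Structure M] (x y : Fin 1 → M) :
    x ∈ solutions selects y ↔ F (x 0) ∧ eval (x 0) (y 0) = y 0 := by
  rw [solutions, Set.mem_ofPred_eq, selects, Formula.realize_inf]
  simp

theorem Generic.not_isCoSimpleType (hq : Generic q) :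
    ¬ IsCoSimpleType (L₁.completeTheory (Pt q)) (formulasOf (objectType q)) := by
  intro h
  -- The depth of a node gives the class and its last entry gives the element, so siblings name
  -- different elements of one class. The default `0` matters only at the root.
  refine h ⟨1, selects, 2, Theory.ModelType.of _ (Pt q),
    fun η _ => (obj η.length (η.getLast?.getD 0) : Pt q), ?_, ?_, ?_⟩
  · rintro η s hs ⟨x, hx⟩
    obtain ⟨i, j, hij, rfl⟩ := Finset.card_eq_two.1 hs
    have h1 := (mem_solutions_selects (M := Pt q) _ _).1 (Set.mem_iInter₂.1 hx i (by simp))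
    have h2 := (mem_solutions_selects (M := Pt q) _ _).1 (Set.mem_iInter₂.1 hx j (by simp))
    obtain ⟨f, hf⟩ := exists_fn_of_F h1.1
    rw [hf] at h1 h2
    simp only [List.length_append, List.getLast?_append, List.getLast?_singleton,
      Option.some_or, Option.getD_some, eval_fn_obj, obj.injEq, true_and] at h1 h2
    exact hij (h1.2.symm.trans h2.2)
  · intro η s
    -- Nodes of a branch lie in distinct classes, so genericity yields a function selecting any
    -- finite number of them.
    obtain ⟨f, -, hf⟩ := hq.exists_fn ∅ s fun i => (restrict η i).getLast?.getD 0
    refine ⟨fun _ => (fn f : Pt q), Set.mem_iInter₂.2 fun i hi => ?_⟩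
    refine (mem_solutions_selects (M := Pt q) _ _).2 ⟨by simp, ?_⟩
    have hl : (restrict η i).length = i := by simp [restrict]
    simp only [eval_fn_obj, hl, hf i hi]
  · intro η ψ hψ
    exact hq.realize_of_mem_objectType hψ (O_obj _ _)

end Selector

theorem corollary9p12 :
    (∃ (M : Type) (_ : Selector.L₁.Structure M) (_ : Countable M),
      IsFraisseLimit Selector.K₁ M) ∧
    ∀ (M : Type) [Selector.L₁.Structure M] [Countable M], IsFraisseLimit Selector.K₁ M →
      TreeProperties.NSOP1 (Selector.L₁.completeTheory M) ∧
      ∃ p : (Selector.L₁.completeTheory M).CompleteType (Fin 1),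
        TreeProperties.Axiomatizes (Selector.L₁.completeTheory M) Selector.formulaO p ∧
        TreeProperties.IsSimpleType (Selector.L₁.completeTheory M) (TreeProperties.formulasOf p) ∧
        ¬ TreeProperties.IsCoSimpleType (Selector.L₁.completeTheory M)
          (TreeProperties.formulasOf p) := by
  have hq := Selector.generic_explicitValue
  refine ⟨⟨Selector.Pt Selector.explicitValue, inferInstance, inferInstance, hq.isFraisseLimit⟩,
    fun M _ _ hM => ?_⟩
  -- By uniqueness of the limit, the theory is that of the explicit generic structure.
  obtain ⟨g⟩ := IsFraisseLimit.nonempty_equiv hM hq.isFraisseLimit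
  have hT : Selector.L₁.completeTheory M =
      Selector.L₁.completeTheory (Selector.Pt Selector.explicitValue) :=
    g.toElementaryEmbedding.elementarilyEquivalent.completeTheory_eq
  rw [hT]
  exact ⟨hq.nsop1, Selector.objectType _, hq.axiomatizes, hq.isSimpleType, hq.not_isCoSimpleType⟩
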